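/- **Conventions.** Graphs are finite; loops and parallel edges are allowed. Let $\Lambda$ be a set of colors, $\Lambda_0\subseteq\Lambda$, $\nu\notin\Lambda$, $\Lambda_0'=\Lambda_0\cup\{\nu\}$, and let $\mathcal R$ be a commutative ring. In a colored graph the edges with colors in $\Lambda\setminus\Lambda_0$ are called *regular*; the edges with colors in $\Lambda_0'$ are called *zero edges*. *Vertex pivots.* A vertex pivot splits a graph that is obtained from disjoint graphs $G_1,G_2$ by identifying $u_1\in V(G_1)$ with $u_2\in V(G_2)$, and merges $G_1,G_2$ again by identifying $v_1$ with $v_2$, where $v_i$ lies in the connected component of $u_i$ in $G_i$. Two colored graphs are vertex pivot equivalent if they are related by a sequence of vertex pivots and color-preserving isomorphisms; $[\Gamma]$ is the class of $\Gamma$, and $\mathrm{VP}(\Lambda_0')$ is the set of classes of $\Lambda_0'$-colored graphs. *Rings.* Let $\mathcal T$ be the quotient of $\mathcal R[x_\lambda,X_\lambda,y_\lambda,Y_\lambda:\lambda\in\Lambda\setminus\Lambda_0]$ by the ideal generated by all $$\det\begin{pmatrix}X_\lambda&y_\lambda\\X_\mu&y_\mu\end{pmatrix}-\det\begin{pmatrix}x_\lambda&Y_\lambda\\x_\mu&Y_\mu\end{pmatrix},\qquad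 \det\begin{pmatrix}x_\lambda&Y_\lambda\\x_\mu&Y_\mu\end{pmatrix}-\det\begin{pmatrix}x_\lambda&y_\lambda\\x_\mu&y_\mu\end{pmatrix},$$ and let $\mathcal T[z]=\mathcal T[z_{[\Gamma]}:[\Gamma]\in\mathrm{VP}(\Lambda_0')]$. *Relative Tutte polynomial.* Let $G$ be a colored graph with set of zero edges $\mathcal H$. A set $\mathcal C\subseteq E(G)\setminus\mathcal H$ is a *contracting set* if $\mathcal C$ contains no cycle and $\mathcal D=E(G)\setminus(\mathcal C\cup\mathcal H)$ contains no cocycle (a minimal set of edges whose removal increases the number of connected components). A *proper labeling* is a map $\phi:E(G)\to\mathbb N$ that is $0$ exactly on $\mathcal H$ and injective on $E(G)\setminus\mathcal H$. An edge $f\in\mathcal C$ is *internally active* if $\mathcal D\cup\{f\}$ contains a cocycle in which $f$ has the smallest label; $f\in\mathcal D$ is *externally active* if $\mathcal C\cup\{f\}$ contains a cycle in which $f$ has the smallest label. The weight of a regular edge of color $\lambda$ is $X_\lambda$ or $x_\lambda$ if it is in $\mathcal C$ and is, respectively is not, internally active, and $Y_\lambda$ or $y_\lambda$ if it is in $\mathcal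 D$ and is, respectively is not, externally active. With $\mathcal H_{\mathcal C}$ the graph obtained by contracting $\mathcal C$ and deleting $\mathcal D$, $$T_{\mathcal H}(G)=\sum_{\mathcal C}\Big(\prod_{f\notin\mathcal H}\mathrm{weight}(f)\Big)z_{[\mathcal H_{\mathcal C}]}\in\mathcal T[z],$$ computed with any proper labeling. *Pointed polynomials.* Let $G$ be a connected colored graph with a distinguished edge $e$ that is neither a loop nor a bridge; $e$ is the only edge of color $\nu$. Let $\mathcal H$ be the set of zero edges other than $e$, and $\mathcal H'=\mathcal H\cup\{e\}$. Let $\pi_C,\pi_L,\pi_0,\pi_/,\pi_-$ be the $\mathcal T$-algebra endomorphisms of $\mathcal T[z]$ that send $z_{[\Gamma]}$ to $0$, except that, if $\Gamma$ has exactly one edge $f$ of color $\nu$: $\pi_C(z_{[\Gamma]})=z_{[\Gamma]}$ if $f$ is a bridge; $\pi_L(z_{[\Gamma]})=z_{[\Gamma]}$ if $f$ is a loop; $\pi_0(z_{[\Gamma]})=z_{[\Gamma]}$ if $f$ is neither; $\pi_/(z_{[\Gamma]})=z_{[\Gamma/f]}$ if $f$ is not a loop; $\pi_-(z_{[\Gamma]})=z_{[\Gamma-f]}$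 if $f$ is not a bridge. Put $$T_C=\pi_/\pi_C\,T_{\mathcal H'}(G),\quad T_L=\pi_-\pi_L\,T_{\mathcal H'}(G),\quad T_0=\pi_0\,T_{\mathcal H'}(G),$$ $$T_/=T_{\mathcal H}(G/e)-\pi_/T_0,\qquad T_-=T_{\mathcal H}(G-e)-\pi_-T_0.$$ **Theorem.** For every color $\mu\in\Lambda\setminus\Lambda_0$ the following identities hold in $\mathcal T[z]$, whichever proper labelings of $G$, of $G/e$ and of $G-e$ are used to compute $T_{\mathcal H'}(G)$, $T_{\mathcal H}(G/e)$ and $T_{\mathcal H}(G-e)$: $$x_\mu\,(T_/ -T_C)=(Y_\mu-y_\mu)\,T_L,\qquad y_\mu\,(T_--T_L)=(X_\mu-x_\mu)\,T_C.$$ -/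

import Mathlib

universe u v w

/-- A finite multigraph (loops and parallel edges allowed) whose edges are colored by `K`. -/
structure ColoredGraph (K : Type v) : Type (max v (u + 1)) where
  /-- vertices -/
  V : Type u
  /-- edges -/
  E : Type u
  /-- the unordered pair of endpoints of an edge -/
  ends : E → Sym2 V
  /-- the color of an edge -/
  color : E → K
  finite_V : Finite V
  finite_E : Finite E

namespace ColoredGraph

variable {K : Type v} {L : Type w}

/-- Two vertices are related when they are joined by a walk that uses only edges of `S`. -/
def conn (G : ColoredGraph.{u} K) (S : Set G.E) : Setoid G.V :=
  Relation.EqvGen.setoid fun a b => ∃ f ∈ S, G.ends f = s(a, b)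

/-- Connected graphs (in particular there is at least one vertex). -/
def IsConnected (G : ColoredGraph.{u} K) : Prop :=
  Nonempty G.V ∧ ∀ a b, G.conn Set.univ a b

def IsLoop (G : ColoredGraph.{u} K) (f : G.E) : Prop := (G.ends f).IsDiag

/-- A bridge (coloop): an edge whose removal disconnects its endpoints. -/
def IsBridge (G : ColoredGraph.{u} K) (f : G.E) : Prop :=
  ∀ a b, G.ends f = s(a, b) → ¬ G.conn {f}ᶜ a b

/-- Edge sets of cycles: `v 0, f 0, v 1, f 1, …, v n, f n, v 0` with distinct vertices and
distinct edges (indices modulo `n + 1`; a loop is a cycle with `n = 0`). -/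
def IsCycle (G : ColoredGraph.{u} K) (Z : Set G.E) : Prop :=
  ∃ (n : ℕ) (v : Fin (n + 1) → G.V) (f : Fin (n + 1) → G.E),
    Function.Injective v ∧ Function.Injective f ∧
    (∀ i, G.ends (f i) = s(v i, v (i + 1))) ∧ Z = Set.range f

/-- Removing the edges of `D` increases the number of connected components, i.e. it separates
two vertices that lie in one component. -/
def Separates (G : ColoredGraph.{u} K) (D : Set G.E) : Prop :=
  ∃ a b, G.conn Set.univ a b ∧ ¬ G.conn Dᶜ a b

/-- Cocycles: minimal sets of edges whose removal increases the number of components. -/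
def IsCocycle (G : ColoredGraph.{u} K) (D : Set G.E) : Prop :=
  Minimal G.Separates D

/-- `C` is a contracting set with respect to `H`. -/
def IsContracting (G : ColoredGraph.{u} K) (H C : Set G.E) : Prop :=
  C ⊆ Hᶜ ∧ (∀ Z, G.IsCycle Z → ¬ Z ⊆ C) ∧ (∀ Z, G.IsCocycle Z → ¬ Z ⊆ (C ∪ H)ᶜ)

/-- Proper labelings: zero exactly on `H`, injective off `H`. -/
def IsProperLabeling (G : ColoredGraph.{u} K) (H : Set G.E) (φ : G.E → ℕ) : Prop :=
  (∀ f, φ f = 0 ↔ f ∈ H) ∧ Set.InjOn φ Hᶜ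

/-- The edge `f ∈ C` is internally active: `D ∪ {f}` contains a cocycle with smallest edge `f`,
where `D = (C ∪ H)ᶜ`. -/
def InternallyActive (G : ColoredGraph.{u} K) (H : Set G.E) (φ : G.E → ℕ) (C : Set G.E)
    (f : G.E) : Prop :=
  ∃ Z, G.IsCocycle Z ∧ Z ⊆ insert f (C ∪ H)ᶜ ∧ f ∈ Z ∧ ∀ g ∈ Z, φ f ≤ φ g

/-- The edge `f` of the deleting set is externally active: `C ∪ {f}` contains a cycle with
smallest edge `f`. -/
def ExternallyActive (G : ColoredGraph.{u} K) (φ : G.E → ℕ) (C : Set G.E) (f : G.E) : Prop :=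
  ∃ Z, G.IsCycle Z ∧ Z ⊆ insert f C ∧ f ∈ Z ∧ ∀ g ∈ Z, φ f ≤ φ g

/-- The minor that contracts the edges of `C`, keeps exactly the edges of `S` (now colored
by `c`) and deletes all other edges. -/
def minor (G : ColoredGraph.{u} K) (C S : Set G.E) (c : S → L) : ColoredGraph.{u} L where
  V := Quotient (G.conn C)
  E := S
  ends := fun f => (G.ends f).map (Quotient.mk (G.conn C))
  color := c
  finite_V := by have := G.finite_V; infer_instance
  finite_E := by have := G.finite_E; infer_instance

/-- `G / f` -/
def contractEdge (G : ColoredGraph.{u} K) (f : G.E) : ColoredGraph.{u} K :=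
  G.minor {f} {f}ᶜ fun g => G.color g

/-- `G - f` -/
def deleteEdge (G : ColoredGraph.{u} K) (f : G.E) : ColoredGraph.{u} K :=
  G.minor ∅ {f}ᶜ fun g => G.color g

/-- Isomorphisms of colored graphs. -/
structure Iso (G G' : ColoredGraph.{u} K) where
  onV : G.V ≃ G'.V
  onE : G.E ≃ G'.E
  ends_eq : ∀ f, G'.ends (onE f) = (G.ends f).map onV
  color_eq : ∀ f, G'.color (onE f) = G.color f

/-- Vertex splicing: the disjoint union of `G₁` and `G₂` with `a₁` and `a₂` identified. -/
def splice (G₁ G₂ : ColoredGraph.{u} K) (a₁ : G₁.V) (a₂ : G₂.V) : ColoredGraph.{u} K where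
  V := Quot fun p q : G₁.V ⊕ G₂.V => p = Sum.inl a₁ ∧ q = Sum.inr a₂
  E := G₁.E ⊕ G₂.E
  ends := Sum.elim (fun f => (G₁.ends f).map fun a => Quot.mk _ (Sum.inl a))
    (fun f => (G₂.ends f).map fun a => Quot.mk _ (Sum.inr a))
  color := Sum.elim G₁.color G₂.color
  finite_V := by have := G₁.finite_V; have := G₂.finite_V; infer_instance
  finite_E := by have := G₁.finite_E; have := G₂.finite_E; infer_instance

/-- One isomorphism or one vertex pivot: a graph that is spliced from `G₁` and `G₂` at `a₁`, `a₂`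
is split there and spliced again at vertices `b₁`, `b₂` of the components of `a₁`, `a₂`. -/
inductive PivotStep : ColoredGraph.{u} K → ColoredGraph.{u} K → Prop
  | iso {G G' : ColoredGraph.{u} K} (i : Iso G G') : PivotStep G G'
  | pivot (G₁ G₂ : ColoredGraph.{u} K) {a₁ b₁ : G₁.V} {a₂ b₂ : G₂.V}
      (h₁ : G₁.conn Set.univ a₁ b₁) (h₂ : G₂.conn Set.univ a₂ b₂) :
      PivotStep (splice G₁ G₂ a₁ a₂) (splice G₁ G₂ b₁ b₂)

end ColoredGraph

/-- Vertex pivot equivalence classes of `K`-colored graphs: the quotient by the equivalence relation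
generated by isomorphisms and vertex pivots. -/
def VP (K : Type v) : Type (max v (u + 1)) :=
  Quot (ColoredGraph.PivotStep.{u} (K := K))

/-- The class `[Γ]`. -/
def ColoredGraph.cls {K : Type v} (Γ : ColoredGraph.{u} K) : VP.{u} K := Quot.mk _ Γ

section Rings

/-- The four kinds of variables `x, X, y, Y`. -/
inductive TutteVar
  | x
  | X
  | y
  | Y

variable (R : Type*) [CommRing R] (Λ : Type*)

/-- A variable of the polynomial ring `R[x_l, X_l, y_l, Y_l : l ∈ Λ]`. -/
noncomputable def TutteVar.poly (t : TutteVar) (l : Λ) : MvPolynomial (TutteVar × Λ) R :=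
  MvPolynomial.X (t, l)

open TutteVar in
/-- The ideal generated by the differences of determinants
`|X_l y_l; X_m y_m| - |x_l Y_l; x_m Y_m|` and `|x_l Y_l; x_m Y_m| - |x_l y_l; x_m y_m|`. -/
noncomputable def tutteIdeal : Ideal (MvPolynomial (TutteVar × Λ) R) :=
  Ideal.span {p | ∃ l m : Λ,
    p = Matrix.det !![X.poly R Λ l, y.poly R Λ l; X.poly R Λ m, y.poly R Λ m]
        - Matrix.det !![x.poly R Λ l, Y.poly R Λ l; x.poly R Λ m, Y.poly R Λ m] ∨
    p = Matrix.det !![x.poly R Λ l, Y.poly R Λ l; x.poly R Λ m, Y.poly R Λ m]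
        - Matrix.det !![x.poly R Λ l, y.poly R Λ l; x.poly R Λ m, y.poly R Λ m]}

/-- The Tutte ring of the color set `Λ`. -/
abbrev TutteRing : Type _ := MvPolynomial (TutteVar × Λ) R ⧸ tutteIdeal R Λ

/-- The pointed Tutte ring: the polynomial ring over the Tutte ring of the set `Λ` of
colors of regular edges, with a variable `z_[Γ]` for each vertex pivot class of graphs colored by
the set `Λ₀` of colors of zero edges. -/
abbrev PointedTutteRing (Λ₀ : Type v) : Type _ :=
  MvPolynomial (VP.{u} Λ₀) (TutteRing R Λ)

/-- A variable `x_l, X_l, y_l, Y_l` as an element of the Tutte ring. -/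
noncomputable def TutteVar.elt {Λ : Type*} (t : TutteVar) (l : Λ) : TutteRing R Λ :=
  Ideal.Quotient.mk _ (t.poly R Λ l)

end Rings

/-! Graphs colored by `Λ₁ ⊕ Λ₀`: edges with a color in `Λ₁` are regular, those with a color in `Λ₀`
are zero edges. -/

namespace ColoredGraph

variable (R : Type*) [CommRing R] {Λ₁ : Type*} {Λ₀ : Type v}

/-- The set of zero edges. -/
def zeroEdges (G : ColoredGraph.{u} (Λ₁ ⊕ Λ₀)) : Set G.E := {f | (G.color f).isRight}

/-- The graph on the zero edges obtained by contracting `C` and deleting all other regular edges. -/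
def terminal (G : ColoredGraph.{u} (Λ₁ ⊕ Λ₀)) (C : Set G.E) : ColoredGraph.{u} Λ₀ :=
  G.minor C G.zeroEdges fun f => (G.color f).getRight f.2

open scoped Classical in
/-- The weight of a regular edge with respect to a contracting set (zero edges have no weight; they
get the factor `1`). -/
noncomputable def weight (G : ColoredGraph.{u} (Λ₁ ⊕ Λ₀)) (φ : G.E → ℕ) (C : Set G.E) (f : G.E) :
    TutteRing R Λ₁ :=
  match G.color f with
  | Sum.inr _ => 1
  | Sum.inl l =>
    if f ∈ C then
      if G.InternallyActive G.zeroEdges φ C f then TutteVar.X.elt R l else TutteVar.x.elt R l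
    else
      if G.ExternallyActive φ C f then TutteVar.Y.elt R l else TutteVar.y.elt R l

/-- The universal relative Tutte polynomial of `G` with respect to its set of zero edges, computed
with the labeling `φ`. -/
noncomputable def relTutte (G : ColoredGraph.{u} (Λ₁ ⊕ Λ₀)) (φ : G.E → ℕ) :
    PointedTutteRing.{u} R Λ₁ Λ₀ :=
  ∑ᶠ C ∈ {C : Set G.E | G.IsContracting G.zeroEdges C},
    MvPolynomial.C (∏ᶠ f ∈ G.zeroEdgesᶜ, G.weight R φ C f) * MvPolynomial.X (G.terminal C).cls

end ColoredGraph

/-! The facts below show that the maps on classes that follow are well defined. -/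

namespace ColoredGraph

variable {K : Type v} {L : Type w}

theorem conn_rec {G : ColoredGraph.{u} K} {S : Set G.E} {X : Type*} (r : Setoid X) (F : G.V → X)
    (h : ∀ f ∈ S, ∀ a b, G.ends f = s(a, b) → r (F a) (F b)) {p q : G.V} (hpq : G.conn S p q) :
    r (F p) (F q) := by
  induction hpq with
  | rel a b hab => obtain ⟨f, hf, e⟩ := hab; exact h f hf a b e
  | refl a => exact r.refl _
  | symm a b _ ih => exact r.symm ih
  | trans a b c _ _ ih₁ ih₂ => exact r.trans ih₁ ih₂

theorem conn_of_ends {G : ColoredGraph.{u} K} {S : Set G.E} {f : G.E} (hf : f ∈ S) {a b : G.V}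
    (h : G.ends f = s(a, b)) : G.conn S a b :=
  Relation.EqvGen.rel _ _ ⟨f, hf, h⟩

theorem conn_mono {G : ColoredGraph.{u} K} {S T : Set G.E} (h : S ⊆ T) {a b : G.V}
    (hab : G.conn S a b) : G.conn T a b :=
  conn_rec (G.conn T) id (fun _ hf _ _ e => conn_of_ends (h hf) e) hab

/-- Connectivity in a minor. -/
theorem conn_minor {G : ColoredGraph.{u} K} {C S : Set G.E} {c : S → L} {a b : G.V}
    (hab : G.conn (C ∪ S) a b) :
    (G.minor C S c).conn Set.univ (Quotient.mk (G.conn C) a) (Quotient.mk (G.conn C) b) := by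
  refine conn_rec ((G.minor C S c).conn Set.univ) (fun a => Quotient.mk (G.conn C) a) ?_ hab
  rintro f (hf | hf) a b e
  · have : Quotient.mk (G.conn C) a = Quotient.mk (G.conn C) b :=
      Quotient.sound (conn_of_ends hf e)
    simp only [this]
    exact Setoid.refl' _ _
  · refine conn_of_ends (f := (⟨f, hf⟩ : S)) (Set.mem_univ _) ?_
    simp [minor, e]

namespace Iso

/-- The inverse isomorphism. -/
def symm {G G' : ColoredGraph.{u} K} (i : Iso G G') : Iso G' G where
  onV := i.onV.symm
  onE := i.onE.symm
  ends_eq f := by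
    have := i.ends_eq (i.onE.symm f)
    simp only [Equiv.apply_symm_apply] at this
    simp [this, Sym2.map_map]
  color_eq f := by
    have := i.color_eq (i.onE.symm f)
    simpa using this.symm

theorem conn {G G' : ColoredGraph.{u} K} (i : Iso G G') {S : Set G.E} {S' : Set G'.E}
    (h : ∀ f ∈ S, i.onE f ∈ S') {a b : G.V} (hab : G.conn S a b) :
    G'.conn S' (i.onV a) (i.onV b) := by
  refine conn_rec (G'.conn S') i.onV ?_ hab
  intro f hf a b e
  exact conn_of_ends (h f hf) (by rw [i.ends_eq, e]; rfl)

theorem isLoop {G G' : ColoredGraph.{u} K} (i : Iso G G') (f : G.E) :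
    G'.IsLoop (i.onE f) ↔ G.IsLoop f := by
  unfold IsLoop
  rw [i.ends_eq]
  induction G.ends f with
  | _ a b => simp

theorem isBridge_of {G G' : ColoredGraph.{u} K} (i : Iso G G') (f : G.E) (h : G.IsBridge f) :
    G'.IsBridge (i.onE f) := by
  intro a b e hab
  refine h (i.symm.onV a) (i.symm.onV b) ?_ (i.symm.conn ?_ hab)
  · have := i.symm.ends_eq (i.onE f)
    rw [e] at this
    simpa [symm] using this
  · intro g hg h'
    apply hg
    simp only [symm, Set.mem_singleton_iff] at h' ⊢
    rw [← h']; simp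

theorem isBridge {G G' : ColoredGraph.{u} K} (i : Iso G G') (f : G.E) :
    G'.IsBridge (i.onE f) ↔ G.IsBridge f := by
  refine ⟨fun h => ?_, i.isBridge_of f⟩
  have := i.symm.isBridge_of _ h
  simpa [symm] using this

/-- An isomorphism induces isomorphisms of minors. -/
def minor {G G' : ColoredGraph.{u} K} (i : Iso G G') {C S : Set G.E} {C' S' : Set G'.E}
    {c : S → L} {c' : S' → L} (hC : ∀ f, f ∈ C ↔ i.onE f ∈ C') (hS : ∀ f, f ∈ S ↔ i.onE f ∈ S')
    (hc : ∀ f (h : f ∈ S), c' ⟨i.onE f, (hS f).1 h⟩ = c ⟨f, h⟩) :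
    Iso (G.minor C S c) (G'.minor C' S' c') where
  onV := Quotient.congr i.onV (by
    intro a b
    refine ⟨fun h => i.conn (fun f hf => (hC f).1 hf) h, fun h => ?_⟩
    have := i.symm.conn (S' := C) (fun f hf => (hC _).2 (by simpa [symm] using hf)) h
    simpa [symm] using this)
  onE := i.onE.subtypeEquiv hS
  ends_eq := by
    rintro ⟨f, hf⟩
    change (G'.ends (i.onE f)).map (Quotient.mk (G'.conn C')) = ((G.ends f).map _).map _
    rw [i.ends_eq]
    generalize G.ends f = z
    induction z with | _ a b => rfl
  color_eq := by
    rintro ⟨f, hf⟩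
    exact hc f hf

end Iso

/-- Splicing is symmetric. -/
def spliceComm (G₁ G₂ : ColoredGraph.{u} K) (a₁ : G₁.V) (a₂ : G₂.V) :
    Iso (splice G₁ G₂ a₁ a₂) (splice G₂ G₁ a₂ a₁) where
  onV :=
    { toFun := Quot.lift (fun p => Quot.mk _ p.swap)
        (by rintro _ _ ⟨rfl, rfl⟩; exact (Quot.sound ⟨rfl, rfl⟩).symm)
      invFun := Quot.lift (fun p => Quot.mk _ p.swap)
        (by rintro _ _ ⟨rfl, rfl⟩; exact (Quot.sound ⟨rfl, rfl⟩).symm)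
      left_inv := by rintro ⟨p | p⟩ <;> rfl
      right_inv := by rintro ⟨p | p⟩ <;> rfl }
  onE := Equiv.sumComm _ _
  ends_eq := by
    rintro (f | f) <;> simp [splice, Sym2.map_map] <;> rfl
  color_eq := by rintro (f | f) <;> rfl

section Splice

variable (G₁ G₂ : ColoredGraph.{u} K) (a₁ : G₁.V) (a₂ : G₂.V)

/-- The retraction of a splicing onto its first part. -/
def spliceRetract : (splice G₁ G₂ a₁ a₂).V → G₁.V :=
  Quot.lift (Sum.elim id fun _ => a₁) (by rintro _ _ ⟨rfl, rfl⟩; rfl)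

theorem exists_ends (G : ColoredGraph.{u} K) (f : G.E) : ∃ c d, G.ends f = s(c, d) := by
  induction G.ends f with | _ c d => exact ⟨c, d, rfl⟩

theorem splice_ends_inl {f : G₁.E} {p q : (splice G₁ G₂ a₁ a₂).V}
    (e : (splice G₁ G₂ a₁ a₂).ends (Sum.inl f) = s(p, q)) :
    G₁.ends f = s(spliceRetract G₁ G₂ a₁ a₂ p, spliceRetract G₁ G₂ a₁ a₂ q) := by
  obtain ⟨c, d, hcd⟩ := G₁.exists_ends f
  simp only [splice, Sum.elim_inl, hcd] at e
  rw [hcd]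
  exact congrArg (Sym2.map (spliceRetract G₁ G₂ a₁ a₂)) e

theorem splice_ends_inr {f : G₂.E} {p q : (splice G₁ G₂ a₁ a₂).V}
    (e : (splice G₁ G₂ a₁ a₂).ends (Sum.inr f) = s(p, q)) :
    s(a₁, a₁) = s(spliceRetract G₁ G₂ a₁ a₂ p, spliceRetract G₁ G₂ a₁ a₂ q) := by
  obtain ⟨c, d, hcd⟩ := G₂.exists_ends f
  simp only [splice, Sum.elim_inr, hcd] at e
  exact congrArg (Sym2.map (spliceRetract G₁ G₂ a₁ a₂)) e

theorem splice_isLoop_inl (f : G₁.E) :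
    (splice G₁ G₂ a₁ a₂).IsLoop (Sum.inl f) ↔ G₁.IsLoop f := by
  unfold IsLoop
  simp only [splice, Sum.elim_inl]
  induction G₁.ends f with
  | _ a b =>
    simp only [Sym2.map_mk, Sym2.mk_isDiag_iff]
    refine ⟨fun h => ?_, fun h => by rw [h]⟩
    exact congrArg (spliceRetract G₁ G₂ a₁ a₂) h

theorem splice_isBridge_inl (f : G₁.E) :
    (splice G₁ G₂ a₁ a₂).IsBridge (Sum.inl f) ↔ G₁.IsBridge f := by
  constructor
  · intro h a b e hab
    refine h (Quot.mk _ (Sum.inl a)) (Quot.mk _ (Sum.inl b)) (by simp [splice, e]) ?_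
    refine conn_rec ((splice G₁ G₂ a₁ a₂).conn {Sum.inl f}ᶜ)
      (fun a => Quot.mk _ (Sum.inl a)) ?_ hab
    intro g hg c d e'
    refine conn_of_ends (f := (Sum.inl g : G₁.E ⊕ G₂.E)) ?_ (by simp [splice, e'])
    intro h'
    exact hg (Sum.inl_injective h')
  · intro h p q e hpq
    refine h _ _ (splice_ends_inl G₁ G₂ a₁ a₂ e) ?_
    refine conn_rec (G₁.conn {f}ᶜ) (spliceRetract G₁ G₂ a₁ a₂) ?_ hpq
    rintro (g | g) hg p q e'
    · refine conn_of_ends (f := g) ?_ (splice_ends_inl G₁ G₂ a₁ a₂ e')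
      exact fun h' => hg (congrArg Sum.inl h')
    · have h3 := splice_ends_inr G₁ G₂ a₁ a₂ e'
      simp only [Sym2.eq_iff] at h3
      rcases h3 with ⟨h4, h5⟩ | ⟨h4, h5⟩ <;> rw [← h4, ← h5]

/-- A minor taken in the first part of a splicing. -/
def spliceMinor (f : G₁.E) (C : Set G₁.E) (C' : Set (G₁.E ⊕ G₂.E)) (hC : C' = Sum.inl '' C) :
    Iso ((splice G₁ G₂ a₁ a₂).minor C' {Sum.inl f}ᶜ fun g => (splice G₁ G₂ a₁ a₂).color g)
      (splice (G₁.minor C {f}ᶜ fun g => G₁.color g) G₂ (Quotient.mk (G₁.conn C) a₁) a₂) where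
  onV :=
    { toFun := Quotient.lift (Quot.lift (Sum.elim
          (fun a => Quot.mk _ (Sum.inl (Quotient.mk (G₁.conn C) a)))
          (fun b => Quot.mk _ (Sum.inr b)))
          (by
            rintro _ _ ⟨rfl, rfl⟩
            exact Quot.sound (r := fun p q : Quotient (G₁.conn C) ⊕ G₂.V =>
              p = Sum.inl (Quotient.mk _ a₁) ∧ q = Sum.inr a₂) ⟨rfl, rfl⟩))
        (by
          subst hC
          intro p q hpq
          refine conn_rec ⊥ _ ?_ hpq
          rintro _ ⟨g, hg, rfl⟩ p q e
          simp only [splice, Sum.elim_inl] at e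
          obtain ⟨c, d, hcd⟩ := G₁.exists_ends g
          have : Quotient.mk (G₁.conn C) c = Quotient.mk (G₁.conn C) d :=
            Quotient.sound (conn_of_ends hg hcd)
          rw [hcd] at e
          rcases Sym2.eq_iff.1 (e : s(_, _) = s(_, _)) with ⟨h1, h2⟩ | ⟨h1, h2⟩
          · rw [← h1, ← h2]
            exact congrArg (fun z => Quot.mk _ (Sum.inl z)) this
          · rw [← h1, ← h2]
            exact congrArg (fun z => Quot.mk _ (Sum.inl z)) this.symm)
      invFun := Quot.lift (Sum.elim
          (Quotient.lift (fun a => Quotient.mk ((splice G₁ G₂ a₁ a₂).conn C')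
            (Quot.mk _ (Sum.inl a))) (by
              subst hC
              intro a b hab
              refine Quotient.sound (conn_rec ((splice G₁ G₂ a₁ a₂).conn (Sum.inl '' C))
                (fun a => Quot.mk _ (Sum.inl a)) ?_ hab)
              intro g hg c d e
              exact conn_of_ends (G := splice G₁ G₂ a₁ a₂) (S := Sum.inl '' C) (f := Sum.inl g)
                (Set.mem_image_of_mem _ hg) (by simp [splice, e])))
          (fun b => Quotient.mk ((splice G₁ G₂ a₁ a₂).conn C') (Quot.mk _ (Sum.inr b))))
        (by
          rintro _ _ ⟨rfl, rfl⟩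
          exact congrArg (Quotient.mk ((splice G₁ G₂ a₁ a₂).conn C'))
            (Quot.sound (r := fun p q : G₁.V ⊕ G₂.V => p = Sum.inl a₁ ∧ q = Sum.inr a₂)
              (And.intro rfl rfl)))
      left_inv := by rintro ⟨⟨p | p⟩⟩ <;> rfl
      right_inv := by
        rintro ⟨p | p⟩
        · exact Quotient.inductionOn (s := G₁.conn C) p fun _ => rfl
        · rfl }
  onE :=
    { toFun := fun g => match g with
        | ⟨Sum.inl g, h⟩ => Sum.inl ⟨g, fun h' => h (congrArg Sum.inl h')⟩
        | ⟨Sum.inr g, _⟩ => Sum.inr g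
      invFun := Sum.elim (fun g => ⟨Sum.inl g.1, fun h' => g.2 (Sum.inl_injective h')⟩)
        (fun g => ⟨Sum.inr g, fun h' => nomatch h'⟩)
      left_inv := by rintro ⟨g | g, h⟩ <;> rfl
      right_inv := by rintro (g | g) <;> rfl }
  ends_eq := by
    rintro ⟨g | g, h⟩ <;> simp only [minor, splice, Sum.elim_inl, Sum.elim_inr, Sym2.map_map] <;> rfl
  color_eq := by rintro ⟨g | g, h⟩ <;> rfl

end Splice

theorem cls_eq_of_iso {G G' : ColoredGraph.{u} K} (i : Iso G G') : G.cls = G'.cls :=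
  Quot.sound (.iso i)

theorem univ_subset_of_mem {E : Type*} (f : E) : (Set.univ : Set E) ⊆ {f} ∪ {f}ᶜ := by
  intro g _; exact em _

theorem conn_compl_of_not_isBridge {G : ColoredGraph.{u} K} {f : G.E} (h : ¬ G.IsBridge f)
    {a b : G.V} (hab : G.conn Set.univ a b) : G.conn {f}ᶜ a b := by
  refine conn_rec (G.conn {f}ᶜ) id ?_ hab
  intro g _ a b e
  by_cases hg : g = f
  · subst hg
    unfold IsBridge at h
    push Not at h
    obtain ⟨c, d, e', hcd⟩ := h
    rw [e] at e'
    rcases Sym2.eq_iff.1 e' with ⟨rfl, rfl⟩ | ⟨rfl, rfl⟩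
    · exact hcd
    · exact Setoid.symm' _ hcd
  · exact conn_of_ends hg e

theorem cls_splice_contractEdge_inl (G₁ G₂ : ColoredGraph.{u} K) {a₁ b₁ : G₁.V} {a₂ b₂ : G₂.V}
    (h₁ : G₁.conn Set.univ a₁ b₁) (h₂ : G₂.conn Set.univ a₂ b₂) (f : G₁.E) :
    ((splice G₁ G₂ a₁ a₂).contractEdge (Sum.inl f)).cls =
      ((splice G₁ G₂ b₁ b₂).contractEdge (Sum.inl f)).cls := by
  refine (cls_eq_of_iso (spliceMinor G₁ G₂ a₁ a₂ f {f} {Sum.inl f} (by simp))).trans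
    (Eq.trans ?_ (cls_eq_of_iso (spliceMinor G₁ G₂ b₁ b₂ f {f} {Sum.inl f} (by simp))).symm)
  exact Quot.sound (.pivot _ _ (conn_minor (conn_mono (univ_subset_of_mem f) h₁)) h₂)

theorem cls_splice_deleteEdge_inl (G₁ G₂ : ColoredGraph.{u} K) {a₁ b₁ : G₁.V} {a₂ b₂ : G₂.V}
    (h₁ : G₁.conn Set.univ a₁ b₁) (h₂ : G₂.conn Set.univ a₂ b₂) (f : G₁.E)
    (hf : ¬ G₁.IsBridge f) :
    ((splice G₁ G₂ a₁ a₂).deleteEdge (Sum.inl f)).cls =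
      ((splice G₁ G₂ b₁ b₂).deleteEdge (Sum.inl f)).cls := by
  refine (cls_eq_of_iso (spliceMinor G₁ G₂ a₁ a₂ f ∅ ∅ (by simp))).trans
    (Eq.trans ?_ (cls_eq_of_iso (spliceMinor G₁ G₂ b₁ b₂ f ∅ ∅ (by simp))).symm)
  exact Quot.sound (.pivot _ _
    (conn_minor (conn_mono Set.subset_union_right (conn_compl_of_not_isBridge hf h₁))) h₂)

namespace Iso

theorem cls_contractEdge {G G' : ColoredGraph.{u} K} (i : Iso G G') (f : G.E) :
    (G.contractEdge f).cls = (G'.contractEdge (i.onE f)).cls :=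
  cls_eq_of_iso (i.minor (by simp) (by simp) (fun f _ => i.color_eq f))

theorem cls_deleteEdge {G G' : ColoredGraph.{u} K} (i : Iso G G') (f : G.E) :
    (G.deleteEdge f).cls = (G'.deleteEdge (i.onE f)).cls :=
  cls_eq_of_iso (i.minor (by simp) (by simp) (fun f _ => i.color_eq f))

end Iso

/-- Loops, bridges, deletion and contraction are compatible with vertex pivots. -/
theorem PivotStep.exists_equiv {G G' : ColoredGraph.{u} K} (h : PivotStep G G') :
    ∃ ε : G.E ≃ G'.E, ∀ f, G'.color (ε f) = G.color f ∧ (G'.IsLoop (ε f) ↔ G.IsLoop f) ∧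
      (G'.IsBridge (ε f) ↔ G.IsBridge f) ∧
      (G.contractEdge f).cls = (G'.contractEdge (ε f)).cls ∧
      (¬ G.IsBridge f → (G.deleteEdge f).cls = (G'.deleteEdge (ε f)).cls) := by
  cases h with
  | iso i =>
    exact ⟨i.onE, fun f => ⟨i.color_eq f, i.isLoop f, i.isBridge f, i.cls_contractEdge f,
      fun _ => i.cls_deleteEdge f⟩⟩
  | @pivot G₁ G₂ a₁ b₁ a₂ b₂ h₁ h₂ =>
    refine ⟨Equiv.refl _, ?_⟩
    rintro (f | f)
    · refine ⟨rfl, (splice_isLoop_inl ..).trans (splice_isLoop_inl ..).symm,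
        (splice_isBridge_inl ..).trans (splice_isBridge_inl ..).symm,
        cls_splice_contractEdge_inl G₁ G₂ h₁ h₂ f, fun hf => ?_⟩
      exact cls_splice_deleteEdge_inl G₁ G₂ h₁ h₂ f fun h' => hf ((splice_isBridge_inl ..).2 h')
    · refine ⟨rfl, ?_, ?_, ?_, fun hf => ?_⟩
      · exact ((spliceComm G₁ G₂ b₁ b₂).isLoop (Sum.inr f)).symm.trans
          ((splice_isLoop_inl ..).trans ((splice_isLoop_inl ..).symm.trans
            ((spliceComm G₁ G₂ a₁ a₂).isLoop (Sum.inr f))))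
      · exact ((spliceComm G₁ G₂ b₁ b₂).isBridge (Sum.inr f)).symm.trans
          ((splice_isBridge_inl ..).trans ((splice_isBridge_inl ..).symm.trans
            ((spliceComm G₁ G₂ a₁ a₂).isBridge (Sum.inr f))))
      · exact ((spliceComm G₁ G₂ a₁ a₂).cls_contractEdge (Sum.inr f)).trans
          ((cls_splice_contractEdge_inl G₂ G₁ h₂ h₁ f).trans
            ((spliceComm G₁ G₂ b₁ b₂).cls_contractEdge (Sum.inr f)).symm)
      · have hf' : ¬ G₂.IsBridge f := fun h' => hf
          (((spliceComm G₁ G₂ a₁ a₂).isBridge (Sum.inr f)).1 ((splice_isBridge_inl ..).2 h'))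
        exact ((spliceComm G₁ G₂ a₁ a₂).cls_deleteEdge (Sum.inr f)).trans
          ((cls_splice_deleteEdge_inl G₂ G₁ h₂ h₁ f hf').trans
            ((spliceComm G₁ G₂ b₁ b₂).cls_deleteEdge (Sum.inr f)).symm)

/-- `f` is the only edge of the distinguished color `none`. -/
def IsPointed (Γ : ColoredGraph.{u} (Option K)) (f : Γ.E) : Prop :=
  ∀ g, Γ.color g = none ↔ g = f

open scoped Classical in
/-- `[op Γ f]` if `Γ` has exactly one edge `f` of the distinguished color and `Q Γ f` holds;
otherwise nothing. -/
noncomputable def pointedOp (Q : (Γ : ColoredGraph.{u} (Option K)) → Γ.E → Prop)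
    (op : (Γ : ColoredGraph.{u} (Option K)) → Γ.E → ColoredGraph.{u} (Option K))
    (Γ : ColoredGraph.{u} (Option K)) : Option (VP.{u} (Option K)) :=
  if h : ∃ f, Γ.IsPointed f ∧ Q Γ f then some (op Γ h.choose).cls else none

theorem pointedOp_eq {Q : (Γ : ColoredGraph.{u} (Option K)) → Γ.E → Prop}
    {op : (Γ : ColoredGraph.{u} (Option K)) → Γ.E → ColoredGraph.{u} (Option K)}
    {Γ Γ' : ColoredGraph.{u} (Option K)} (ε : Γ.E ≃ Γ'.E)
    (hε : ∀ f, Γ'.color (ε f) = Γ.color f) (hQ : ∀ f, Q Γ' (ε f) ↔ Q Γ f)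
    (hop : ∀ f, Q Γ f → (op Γ f).cls = (op Γ' (ε f)).cls) :
    pointedOp Q op Γ = pointedOp Q op Γ' := by
  have hP : ∀ f, Γ.IsPointed f → Γ'.IsPointed (ε f) := by
    intro f hf g
    obtain ⟨g, rfl⟩ := ε.surjective g
    rw [hε, hf g, ε.apply_eq_iff_eq]
  have hP' : ∀ f, Γ'.IsPointed (ε f) → Γ.IsPointed f := by
    intro f hf g
    rw [← hε, hf (ε g), ε.apply_eq_iff_eq]
  unfold pointedOp
  by_cases h : ∃ f, Γ.IsPointed f ∧ Q Γ f
  · have h' : ∃ f, Γ'.IsPointed f ∧ Q Γ' f :=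
      ⟨ε h.choose, hP _ h.choose_spec.1, (hQ _).2 h.choose_spec.2⟩
    rw [dif_pos h, dif_pos h', hop _ h.choose_spec.2]
    have : ε h.choose = h'.choose :=
      (h'.choose_spec.1 _).1 (((hP _ h.choose_spec.1) _).2 rfl)
    rw [this]
  · rw [dif_neg h, dif_neg]
    rintro ⟨f, h1, h2⟩
    obtain ⟨f, rfl⟩ := ε.surjective f
    exact h ⟨f, hP' f h1, (hQ f).1 h2⟩

end ColoredGraph

namespace VP

open ColoredGraph

variable {K : Type v}

/-- `[Γ]` if the only edge of the distinguished color is a bridge. -/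
noncomputable def keepBridge : VP.{u} (Option K) → Option (VP.{u} (Option K)) :=
  Quot.lift (pointedOp (fun Γ f => Γ.IsBridge f) fun Γ _ => Γ) fun _ _ h => by
    obtain ⟨ε, hε⟩ := h.exists_equiv
    exact pointedOp_eq ε (fun f => (hε f).1) (fun f => (hε f).2.2.1) fun _ _ => Quot.sound h

/-- `[Γ]` if the only edge of the distinguished color is a loop. -/
noncomputable def keepLoop : VP.{u} (Option K) → Option (VP.{u} (Option K)) :=
  Quot.lift (pointedOp (fun Γ f => Γ.IsLoop f) fun Γ _ => Γ) fun _ _ h => by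
    obtain ⟨ε, hε⟩ := h.exists_equiv
    exact pointedOp_eq ε (fun f => (hε f).1) (fun f => (hε f).2.1) fun _ _ => Quot.sound h

/-- `[Γ]` if the only edge of the distinguished color is neither a loop nor a bridge. -/
noncomputable def keepZero : VP.{u} (Option K) → Option (VP.{u} (Option K)) :=
  Quot.lift (pointedOp (fun Γ f => ¬ Γ.IsLoop f ∧ ¬ Γ.IsBridge f) fun Γ _ => Γ) fun _ _ h => by
    obtain ⟨ε, hε⟩ := h.exists_equiv
    exact pointedOp_eq ε (fun f => (hε f).1)
      (fun f => and_congr (not_congr (hε f).2.1) (not_congr (hε f).2.2.1)) fun _ _ => Quot.sound h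

/-- `[Γ / f]` if the only edge `f` of the distinguished color is not a loop. -/
noncomputable def contract : VP.{u} (Option K) → Option (VP.{u} (Option K)) :=
  Quot.lift (pointedOp (fun Γ f => ¬ Γ.IsLoop f) contractEdge) fun _ _ h => by
    obtain ⟨ε, hε⟩ := h.exists_equiv
    exact pointedOp_eq ε (fun f => (hε f).1) (fun f => not_congr (hε f).2.1)
      fun f _ => (hε f).2.2.2.1

/-- `[Γ - f]` if the only edge `f` of the distinguished color is not a bridge. -/
noncomputable def delete : VP.{u} (Option K) → Option (VP.{u} (Option K)) :=
  Quot.lift (pointedOp (fun Γ f => ¬ Γ.IsBridge f) deleteEdge) fun _ _ h => by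
    obtain ⟨ε, hε⟩ := h.exists_equiv
    exact pointedOp_eq ε (fun f => (hε f).1) (fun f => not_congr (hε f).2.2.1)
      fun f hf => (hε f).2.2.2.2 hf

end VP

section Pointed

variable (R : Type*) [CommRing R] (Λ₁ : Type*) {Λ₀ : Type v}

/-- The endomorphism of the pointed Tutte ring over the Tutte ring that sends `z_c` to `z_(m c)`,
and to `0` where `m c` is nothing. -/
noncomputable def piMap (m : VP.{u} (Option Λ₀) → Option (VP.{u} (Option Λ₀))) :
    PointedTutteRing.{u} R Λ₁ (Option Λ₀) →ₐ[TutteRing R Λ₁] PointedTutteRing.{u} R Λ₁ (Option Λ₀) :=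
  MvPolynomial.aeval fun c => (m c).elim 0 MvPolynomial.X

/-- `π_C` -/
noncomputable abbrev piC := piMap.{u} R Λ₁ (VP.keepBridge.{u} (K := Λ₀))

/-- `π_L` -/
noncomputable abbrev piL := piMap.{u} R Λ₁ (VP.keepLoop.{u} (K := Λ₀))

/-- `π_0` -/
noncomputable abbrev piZero := piMap.{u} R Λ₁ (VP.keepZero.{u} (K := Λ₀))

/-- `π_/` -/
noncomputable abbrev piContract := piMap.{u} R Λ₁ (VP.contract.{u} (K := Λ₀))

/-- `π_-` -/
noncomputable abbrev piDelete := piMap.{u} R Λ₁ (VP.delete.{u} (K := Λ₀))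

end Pointed

namespace ColoredGraph

/-! The pointed universal relative Tutte polynomials. The pointed edge `e` has the extra color
`none` for zero edges; `φ` is a labeling of `G` in which `e` is a zero edge, `φ'` is one of
`G / e` or of `G - e`. -/

variable (R : Type*) [CommRing R] {Λ₁ : Type*} {Λ₀ : Type v}
  (G : ColoredGraph.{u} (Λ₁ ⊕ Option Λ₀)) (φ : G.E → ℕ) (e : G.E)

/-- `T_C(G, e)` -/
noncomputable def pointedC : PointedTutteRing.{u} R Λ₁ (Option Λ₀) :=
  piContract R Λ₁ (piC R Λ₁ (G.relTutte R φ))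

/-- `T_L(G, e)` -/
noncomputable def pointedL : PointedTutteRing.{u} R Λ₁ (Option Λ₀) :=
  piDelete R Λ₁ (piL R Λ₁ (G.relTutte R φ))

/-- `T_0(G, e)` -/
noncomputable def pointedZero : PointedTutteRing.{u} R Λ₁ (Option Λ₀) :=
  piZero R Λ₁ (G.relTutte R φ)

/-- `T_/(G, e)` -/
noncomputable def pointedContract (φ' : (G.contractEdge e).E → ℕ) :
    PointedTutteRing.{u} R Λ₁ (Option Λ₀) :=
  (G.contractEdge e).relTutte R φ' - piContract R Λ₁ (G.pointedZero R φ)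

/-- `T_-(G, e)` -/
noncomputable def pointedDelete (φ' : (G.deleteEdge e).E → ℕ) :
    PointedTutteRing.{u} R Λ₁ (Option Λ₀) :=
  (G.deleteEdge e).relTutte R φ' - piDelete R Λ₁ (G.pointedZero R φ)

end ColoredGraph

/-- A variable `x_l, X_l, y_l, Y_l` as an element of the pointed Tutte ring. -/
noncomputable def TutteVar.pointedElt (R : Type*) [CommRing R] {Λ₁ : Type*} (Λ₀ : Type v) (t : TutteVar)
    (l : Λ₁) : PointedTutteRing.{u} R Λ₁ Λ₀ :=
  MvPolynomial.C (t.elt R l)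

/-!
Let `cl` be the closure operator of the cycle matroid of `G` (`ColoredGraph.closure`), and let `H`
be the set of the zero edges. Processing the regular edges in *decreasing* order of their labels
turns the sum over contracting sets into a deletion-contraction recursion (`expand`): with `C` the
set of the edges contracted so far, an edge `f` in `cl C` is a loop and contributes a factor `Y`, an
edge outside the closure of `C`, `H` and the edges still to come is a bridge and contributes `X`, and
any other edge gives `x` times the contraction plus `y` times the deletion. Indeed, the conditions on
cycles and cocycles that define contracting sets and activities only ask whether `f` lies in these
two closures (`ColoredGraph.isContracting_iff`, `ColoredGraph.internallyActive_iff`,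
`ColoredGraph.externallyActive_iff`), and so `ColoredGraph.relTutte_eq_expand` holds.

The recursion does not depend on the order of the edges (`expand_perm`). Two consecutive edges can
be exchanged trivially unless they are parallel or in series; in these cases the contractions of
either edge have the same value, and the exchange is one of the relations of the Tutte ring. For
parallel edges the two contractions are the same graph; for edges in series they differ by a vertex
pivot (`ColoredGraph.cls_minor_series`). Hence the polynomials of `G / e` and `G - e` may be computed
inside `G` with the labeling of `G` (`ColoredGraph.relTutte_minor_eq_expand`).

The theorem then follows by induction along the recursion. In `T_/ - T_C` the terms of `G / e` are
compared with the terms of `G` in which `e` does not become a loop (`expand_contract_sub`). The two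
recursions branch differently only at an edge `f` that becomes parallel to `e`: in `G / e` it is a loop
of weight `Y_f`, in `G` it gives `x_f` (contraction, which makes `e` a loop) and `y_f`. The
difference `Y_f - y_f` is converted by `x_μ (Y_f - y_f) = (Y_μ - y_μ) x_f`, and the
contraction of `f` is counted by `T_L`. The second identity is dual, with an edge `f` in series with
`e` (`expand_delete_sub`).
-/

/-! ### Exchange closures and the deletion-contraction expansion -/

/-- The exchange property of a closure operator on edge sets; with it the operator is the closure
of a matroid. -/
def ClosureOperator.Exchange {E : Type*} (cl : ClosureOperator (Set E)) : Prop :=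
  ∀ (S : Set E) (f g : E), f ∈ cl (insert g S) → f ∉ cl S → g ∈ cl (insert f S)

namespace ClosureOperator

variable {E : Type*} {cl : ClosureOperator (Set E)}

theorem mem_of_mem {S : Set E} {f : E} (h : f ∈ S) : f ∈ cl S := cl.le_closure S h

theorem mem_mono {S T : Set E} {f : E} (h : S ⊆ T) (hf : f ∈ cl S) : f ∈ cl T :=
  cl.monotone h hf

theorem closure_subset {S T : Set E} (h : S ⊆ cl T) : cl S ⊆ cl T :=
  cl.closure_min h (cl.isClosed_closure T)

theorem closure_congr {S T : Set E} (h : S ⊆ cl T) (h' : T ⊆ cl S) : cl S = cl T :=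
  (closure_subset h).antisymm (closure_subset h')

theorem closure_insert {S : Set E} {f : E} (h : f ∈ cl S) : cl (insert f S) = cl S :=
  closure_congr (Set.insert_subset h (cl.le_closure S))
    ((Set.subset_insert _ _).trans (cl.le_closure _))

theorem closure_union_congr {S S' : Set E} (T : Set E) (h : cl S = cl S') :
    cl (S ∪ T) = cl (S' ∪ T) := by
  refine closure_congr (Set.union_subset ?_ ?_) (Set.union_subset ?_ ?_)
  · exact ((cl.le_closure S).trans h.le).trans (cl.monotone Set.subset_union_left)
  · exact Set.subset_union_right.trans (cl.le_closure _)
  · exact ((cl.le_closure S').trans h.ge).trans (cl.monotone Set.subset_union_left)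
  · exact Set.subset_union_right.trans (cl.le_closure _)

theorem closure_insert_congr {S S' : Set E} (f : E) (h : cl S = cl S') :
    cl (insert f S) = cl (insert f S') := by
  simpa only [Set.union_singleton] using closure_union_congr {f} h

namespace Exchange

/-- An element outside the closure of `S` does not help a subset of `S` to span an element of the
closure of `S`. -/
theorem mem_insert_iff (hx : cl.Exchange) {S T : Set E} {f h : E} (hTS : T ⊆ S) (hf : f ∉ cl S)
    (hh : h ∈ cl S) : h ∈ cl (insert f T) ↔ h ∈ cl T := by
  refine ⟨fun h1 => by_contra fun h2 => hf ?_, mem_mono (Set.subset_insert _ _)⟩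
  rw [← closure_insert hh]
  exact mem_mono (Set.insert_subset_insert hTS) (hx _ _ _ h1 h2)

theorem closure_insert_eq (hx : cl.Exchange) {S : Set E} {f g : E} (h : f ∈ cl (insert g S))
    (h' : f ∉ cl S) : cl (insert f S) = cl (insert g S) :=
  closure_congr (Set.insert_subset h ((Set.subset_insert _ _).trans (cl.le_closure _)))
    (Set.insert_subset (hx _ _ _ h h') ((Set.subset_insert _ _).trans (cl.le_closure _)))

end Exchange

end ClosureOperator

section Expansion

open ClosureOperator TutteVar

variable {E A : Type*} [CommRing A] (cl : ClosureOperator (Set E)) (w : TutteVar → E → A)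
  (H : Set E) (Z : Set E → A)

open scoped Classical in
/-- The deletion-contraction expansion along the list of the edges that are still to be processed,
where `C` is the set of the edges contracted so far and `Z` evaluates the final set of contracted
edges. An edge that has become a loop gets the weight `Y`, one that has become a bridge gets `X`. -/
noncomputable def expand : List E → Set E → A
  | [], C => Z C
  | f :: l, C =>
    if f ∈ cl C then w Y f * expand l C
    else if f ∈ cl (C ∪ ({g | g ∈ l} ∪ H)) then
      w x f * expand l (insert f C) + w y f * expand l C
    else w X f * expand l (insert f C)

variable {cl w H Z}

theorem expand_loop {f : E} {l : List E} {C : Set E} (h : f ∈ cl C) :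
    expand cl w H Z (f :: l) C = w Y f * expand cl w H Z l C := if_pos h

theorem expand_bridge {f : E} {l : List E} {C : Set E} (h : f ∉ cl (C ∪ ({g | g ∈ l} ∪ H))) :
    expand cl w H Z (f :: l) C = w X f * expand cl w H Z l (insert f C) :=
  (if_neg fun h' => h (mem_mono Set.subset_union_left h')).trans (if_neg h)

theorem expand_branch {f : E} {l : List E} {C : Set E} (h : f ∉ cl C)
    (h' : f ∈ cl (C ∪ ({g | g ∈ l} ∪ H))) :
    expand cl w H Z (f :: l) C =
      w x f * expand cl w H Z l (insert f C) + w y f * expand cl w H Z l C :=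
  (if_neg h).trans (if_pos h')

theorem expand_add {Z' : Set E → A} (l : List E) (C : Set E) :
    expand cl w H (fun C => Z C + Z' C) l C = expand cl w H Z l C + expand cl w H Z' l C := by
  induction l generalizing C with
  | nil => rfl
  | cons f l ih =>
    simp only [expand, ih]
    split_ifs <;> ring

theorem map_expand {B F : Type*} [CommRing B] [FunLike F A B] [RingHomClass F A B] (ψ : F)
    {w' : TutteVar → E → B}
    (hw : ∀ t f, ψ (w t f) = w' t f) (l : List E) (C : Set E) :
    ψ (expand cl w H Z l C) = expand cl w' H (fun C => ψ (Z C)) l C := by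
  induction l generalizing C with
  | nil => rfl
  | cons f l ih =>
    simp only [expand]
    split_ifs <;> simp [ih, hw]

open scoped Classical in
/-- The expansion is compatible with maps of the edge set that preserve closures. -/
theorem expand_map {E' : Type*} {cl' : ClosureOperator (Set E')} {w' : TutteVar → E' → A}
    {H' : Set E'} {Z' : Set E' → A} (ι : E' → E) (K : Set E)
    (hcl : ∀ S f, f ∈ cl' S ↔ ι f ∈ cl (K ∪ ι '' S)) (hw : ∀ t f, w' t f = w t (ι f))
    (hH : ι '' H' = H) (hZ : ∀ C, Z' C = Z (K ∪ ι '' C)) (l : List E') (C : Set E') :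
    expand cl' w' H' Z' l C = expand cl w H Z (l.map ι) (K ∪ ι '' C) := by
  induction l generalizing C with
  | nil => exact hZ C
  | cons f l ih =>
    have h1 : K ∪ ι '' (C ∪ ({g | g ∈ l} ∪ H')) =
        (K ∪ ι '' C) ∪ ({g | g ∈ l.map ι} ∪ H) := by
      subst hH
      ext g
      simp only [Set.mem_union, Set.mem_image, Set.mem_ofPred_eq, List.mem_map]
      grind
    have h2 : K ∪ ι '' insert f C = insert (ι f) (K ∪ ι '' C) := by
      rw [Set.image_insert_eq, Set.union_insert]
    simp only [List.map_cons, expand, ih, hw, h2]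
    exact if_congr (hcl C f) rfl (if_congr (by rw [hcl, h1]) rfl rfl)

open scoped Classical in
theorem expand_congr_closure (hZ : ∀ C C', cl C = cl C' → Z C = Z C') (l : List E) {C C' : Set E}
    (h : cl C = cl C') : expand cl w H Z l C = expand cl w H Z l C' := by
  induction l generalizing C C' with
  | nil => exact hZ _ _ h
  | cons f l ih =>
    simp only [expand, ih h, ih (closure_insert_congr f h)]
    exact if_congr (by rw [h]) rfl (if_congr (by rw [closure_union_congr _ h]) rfl rfl)

/-- Two edges in series can be interchanged as contracted edges, provided that this holds for the
final evaluation `Z`. In the recursion they stay in series, and, being outside the span of the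
other edges, they do not affect which of those are loops or bridges. -/
theorem expand_series (hx : cl.Exchange)
    (hZ : ∀ C f g, f ∉ cl (C ∪ H) → g ∉ cl (C ∪ H) → f ∈ cl (insert g (C ∪ H)) →
      Z (insert f C) = Z (insert g C))
    (l : List E) {C : Set E} {f g : E} (hf : f ∉ cl (C ∪ ({g | g ∈ l} ∪ H)))
    (hg : g ∉ cl (C ∪ ({g | g ∈ l} ∪ H))) (hfg : f ∈ cl (insert g (C ∪ ({g | g ∈ l} ∪ H)))) :
    expand cl w H Z l (insert f C) = expand cl w H Z l (insert g C) := by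
  induction l generalizing C with
  | nil => exact hZ C f g (by simpa using hf) (by simpa using hg) (by simpa using hfg)
  | cons h l ih =>
    have hS : C ∪ ({g | g ∈ h :: l} ∪ H) = insert h (C ∪ ({g | g ∈ l} ∪ H)) := by
      ext; simp; tauto
    have hins : ∀ k, insert k C ∪ ({g | g ∈ l} ∪ H) = insert k (C ∪ ({g | g ∈ l} ∪ H)) := by
      intro k; rw [Set.insert_union]
    rw [hS] at hf hg hfg
    have hcontract : expand cl w H Z l (insert h (insert f C)) =
        expand cl w H Z l (insert h (insert g C)) := by
      rw [Set.insert_comm h f, Set.insert_comm h g]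
      exact ih (by rwa [hins]) (by rwa [hins]) (by rwa [hins])
    have hdelete : h ∈ cl (C ∪ ({g | g ∈ l} ∪ H)) → expand cl w H Z l (insert f C) =
        expand cl w H Z l (insert g C) := by
      intro hh
      have hcl := closure_insert hh
      refine ih (by rwa [← hcl]) (by rwa [← hcl]) ?_
      rwa [← closure_insert_congr g hcl]
    have hh : h ∈ cl (insert h (C ∪ ({g | g ∈ l} ∪ H))) := mem_of_mem (Set.mem_insert _ _)
    have hC : C ⊆ insert h (C ∪ ({g | g ∈ l} ∪ H)) :=
      Set.subset_union_left.trans (Set.subset_insert _ _)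
    have h1f := hx.mem_insert_iff hC hf hh
    have h1g := hx.mem_insert_iff hC hg hh
    have h2f := hx.mem_insert_iff (Set.subset_insert _ (C ∪ ({g | g ∈ l} ∪ H))) hf hh
    have h2g := hx.mem_insert_iff (Set.subset_insert _ (C ∪ ({g | g ∈ l} ∪ H))) hg hh
    rw [← hins] at h2f h2g
    by_cases hl : h ∈ cl C
    · rw [expand_loop (h1f.2 hl), expand_loop (h1g.2 hl),
        hdelete (mem_mono Set.subset_union_left hl)]
    by_cases hb : h ∈ cl (C ∪ ({g | g ∈ l} ∪ H))
    · rw [expand_branch (mt h1f.1 hl) (h2f.2 hb), expand_branch (mt h1g.1 hl) (h2g.2 hb),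
        hcontract, hdelete hb]
    · rw [expand_bridge (mt h2f.1 hb), expand_bridge (mt h2g.1 hb), hcontract]

theorem union_list_cons (C : Set E) (f : E) (l : List E) :
    C ∪ ({g | g ∈ f :: l} ∪ H) = insert f (C ∪ ({g | g ∈ l} ∪ H)) := by
  ext; simp; tauto

theorem expand_swap_of_loop {f g : E} {l : List E} {C : Set E} (hf : f ∈ cl C) :
    expand cl w H Z (f :: g :: l) C = expand cl w H Z (g :: f :: l) C := by
  have hf' : f ∈ cl (insert g C) := mem_mono (Set.subset_insert _ _) hf
  have hgb : g ∈ cl (C ∪ ({g | g ∈ f :: l} ∪ H)) ↔ g ∈ cl (C ∪ ({g | g ∈ l} ∪ H)) := by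
    rw [union_list_cons, closure_insert (mem_mono Set.subset_union_left hf)]
  rw [expand_loop hf]
  by_cases h1 : g ∈ cl C
  · rw [expand_loop h1, expand_loop h1, expand_loop hf]
    ring
  by_cases h2 : g ∈ cl (C ∪ ({g | g ∈ l} ∪ H))
  · rw [expand_branch h1 h2, expand_branch h1 (hgb.2 h2), expand_loop hf, expand_loop hf']
    ring
  · rw [expand_bridge h2, expand_bridge (mt hgb.1 h2), expand_loop hf']
    ring

theorem expand_swap_of_bridge (hx : cl.Exchange) {f g : E} {l : List E} {C : Set E}
    (hf : f ∉ cl (C ∪ ({k | k ∈ g :: l} ∪ H))) (hg : g ∉ cl C) :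
    expand cl w H Z (f :: g :: l) C = expand cl w H Z (g :: f :: l) C := by
  have hf1 := hf
  rw [union_list_cons] at hf1
  have hf0 : f ∉ cl (C ∪ ({k | k ∈ l} ∪ H)) := mt (mem_mono (Set.subset_insert _ _)) hf1
  have hf2 : f ∉ cl (insert g C ∪ ({k | k ∈ l} ∪ H)) := by rwa [Set.insert_union]
  have hg1 : g ∉ cl (insert f C) := fun h => hf1
    (mem_mono (Set.insert_subset_insert Set.subset_union_left) (hx _ _ _ h hg))
  have hgb : C ∪ ({k | k ∈ f :: l} ∪ H) = insert f C ∪ ({k | k ∈ l} ∪ H) := by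
    rw [union_list_cons, Set.insert_union]
  rw [expand_bridge hf]
  by_cases h2 : g ∈ cl (insert f C ∪ ({g | g ∈ l} ∪ H))
  · rw [expand_branch hg1 h2, expand_branch hg (by rwa [hgb]), expand_bridge hf0,
      expand_bridge hf2, Set.insert_comm]
    ring
  · rw [expand_bridge h2, expand_bridge (by rwa [hgb]), expand_bridge hf2, Set.insert_comm]
    ring

/-- Two edges can be processed in either order if their weights satisfy the relations of the
Tutte ring. -/
theorem expand_swap (hx : cl.Exchange) (hZc : ∀ C C', cl C = cl C' → Z C = Z C')
    (hZ : ∀ C f g, f ∉ cl (C ∪ H) → g ∉ cl (C ∪ H) → f ∈ cl (insert g (C ∪ H)) →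
      Z (insert f C) = Z (insert g C))
    {f g : E} (hY : w x f * (w Y g - w y g) = w x g * (w Y f - w y f))
    (hX : w y g * (w X f - w x f) = w y f * (w X g - w x g))
    (hXY : w X f * w y g - w X g * w y f = w x f * w Y g - w x g * w Y f)
    (l : List E) (C : Set E) :
    expand cl w H Z (f :: g :: l) C = expand cl w H Z (g :: f :: l) C := by
  by_cases hf : f ∈ cl C
  · exact expand_swap_of_loop hf
  by_cases hg : g ∈ cl C
  · exact (expand_swap_of_loop hg).symm
  by_cases hfb : f ∈ cl (C ∪ ({k | k ∈ g :: l} ∪ H))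
  swap
  · exact expand_swap_of_bridge hx hfb hg
  by_cases hgb : g ∈ cl (C ∪ ({k | k ∈ f :: l} ∪ H))
  swap
  · exact (expand_swap_of_bridge hx hgb hf).symm
  rw [expand_branch hf hfb, expand_branch hg hgb]
  rw [union_list_cons] at hfb hgb
  have hfb' : f ∈ cl (insert g C ∪ ({k | k ∈ l} ∪ H)) := by rwa [Set.insert_union]
  have hgb' : g ∈ cl (insert f C ∪ ({k | k ∈ l} ∪ H)) := by rwa [Set.insert_union]
  have hcomm : expand cl w H Z l (insert g (insert f C)) =
      expand cl w H Z l (insert f (insert g C)) := by rw [Set.insert_comm]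
  by_cases hp : f ∈ cl (insert g C)
  · -- the two edges are parallel after the contraction of `C`
    have hp' := hx _ _ _ hp hf
    have hR : expand cl w H Z l (insert f C) = expand cl w H Z l (insert g C) :=
      expand_congr_closure hZc l (hx.closure_insert_eq hp hf)
    rw [expand_loop hp, expand_loop hp', hR]
    by_cases hs : f ∈ cl (C ∪ ({k | k ∈ l} ∪ H))
    · have hs' : g ∈ cl (C ∪ ({k | k ∈ l} ∪ H)) := by rwa [closure_insert hs] at hgb
      rw [expand_branch hf hs, expand_branch hg hs', hR]
      linear_combination expand cl w H Z l (insert g C) * hY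
    · have hs' : g ∉ cl (C ∪ ({k | k ∈ l} ∪ H)) := fun h => hs (by rwa [closure_insert h] at hfb)
      rw [expand_bridge hs, expand_bridge hs', hR]
      linear_combination -expand cl w H Z l (insert g C) * hXY
  · have hp' : g ∉ cl (insert f C) := fun h => hp (hx _ _ _ h hg)
    rw [expand_branch hp hfb', expand_branch hp' hgb', hcomm]
    by_cases hs : f ∈ cl (C ∪ ({k | k ∈ l} ∪ H))
    · have hs' : g ∈ cl (C ∪ ({k | k ∈ l} ∪ H)) := by rwa [closure_insert hs] at hgb
      rw [expand_branch hf hs, expand_branch hg hs']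
      ring
    · -- the two edges are in series after the deletion of the other deleted edges
      have hs' : g ∉ cl (C ∪ ({k | k ∈ l} ∪ H)) := fun h => hs (by rwa [closure_insert h] at hfb)
      rw [expand_bridge hs, expand_bridge hs', expand_series hx hZ l hs hs' hfb]
      linear_combination -expand cl w H Z l (insert g C) * hX

open scoped Classical in
/-- The expansion does not depend on the order in which the edges are processed. -/
theorem expand_perm (hx : cl.Exchange) (hZc : ∀ C C', cl C = cl C' → Z C = Z C')
    (hZ : ∀ C f g, f ∉ cl (C ∪ H) → g ∉ cl (C ∪ H) → f ∈ cl (insert g (C ∪ H)) →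
      Z (insert f C) = Z (insert g C))
    {P : E → Prop} (hY : ∀ f g, P f → P g → w x f * (w Y g - w y g) = w x g * (w Y f - w y f))
    (hX : ∀ f g, P f → P g → w y g * (w X f - w x f) = w y f * (w X g - w x g))
    (hXY : ∀ f g, P f → P g →
      w X f * w y g - w X g * w y f = w x f * w Y g - w x g * w Y f)
    {l l' : List E} (h : l.Perm l') (hl : ∀ f ∈ l, P f) (C : Set E) :
    expand cl w H Z l C = expand cl w H Z l' C := by
  induction h generalizing C with
  | nil => rfl
  | @cons f l l' h ih =>
    have ih := ih fun g hg => hl g (List.mem_cons_of_mem _ hg)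
    have hs : {g | g ∈ l} = {g | g ∈ l'} := Set.ext fun g => h.mem_iff
    simp only [expand, ih]
    exact if_congr Iff.rfl rfl (if_congr (by rw [hs]) rfl rfl)
  | swap f g l =>
    have hg := hl g (by simp)
    have hf := hl f (by simp)
    exact expand_swap hx hZc hZ (hY _ _ hg hf) (hX _ _ hg hf) (hXY _ _ hg hf) l C
  | trans h _ ih₁ ih₂ => exact (ih₁ hl C).trans (ih₂ (fun f hf => hl f (h.mem_iff.2 hf)) C)

open scoped Classical in
/-- A zero edge that is a loop may be dropped. -/
theorem expand_zero_loop {e : E} (l : List E) {C : Set E} (he : e ∈ cl C) :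
    expand cl w (insert e H) Z l C = expand cl w H Z l C := by
  induction l generalizing C with
  | nil => rfl
  | cons f l ih =>
    have h : C ∪ ({g | g ∈ l} ∪ insert e H) = insert e (C ∪ ({g | g ∈ l} ∪ H)) := by
      ext; simp
    simp only [expand, ih he, ih (mem_mono (Set.subset_insert _ _) he)]
    exact if_congr Iff.rfl rfl (if_congr
      (by rw [h, closure_insert (mem_mono Set.subset_union_left he)]) rfl rfl)

theorem expand_eq_zero (l : List E) {C : Set E}
    (hZ : ∀ C', C ⊆ C' → C' ⊆ C ∪ {g | g ∈ l} → Z C' = 0) : expand cl w H Z l C = 0 := by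
  induction l generalizing C with
  | nil => exact hZ C subset_rfl (by simp)
  | cons f l ih =>
    have h1 : expand cl w H Z l C = 0 := ih fun C' h h' => hZ C' h (h'.trans (by
      intro; simp; tauto))
    have h2 : expand cl w H Z l (insert f C) = 0 := ih fun C' h h' =>
      hZ C' ((Set.subset_insert _ _).trans h) (h'.trans (by intro; simp; tauto))
    simp [expand, h1, h2]

theorem expand_congr {Z' : Set E → A} (l : List E) {C : Set E}
    (hZ : ∀ C', C ⊆ C' → C' ⊆ C ∪ {g | g ∈ l} → Z C' = Z' C') :
    expand cl w H Z l C = expand cl w H Z' l C := by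
  induction l generalizing C with
  | nil => exact hZ C subset_rfl (by simp)
  | cons f l ih =>
    have h1 : expand cl w H Z l C = expand cl w H Z' l C := ih fun C' h h' => hZ C' h (h'.trans (by
      intro; simp; tauto))
    have h2 : expand cl w H Z l (insert f C) = expand cl w H Z' l (insert f C) := ih fun C' h h' =>
      hZ C' ((Set.subset_insert _ _).trans h) (h'.trans (by intro; simp; tauto))
    simp only [expand, h1, h2]

open scoped Classical in
/-- If `e` is a bridge, then it may be contracted. -/
theorem expand_contract_bridge (hx : cl.Exchange) {e : E} (l : List E) {C : Set E}
    (he : e ∉ cl (C ∪ ({g | g ∈ l} ∪ H))) :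
    expand cl w (insert e H) (fun C => Z (insert e C)) l C =
      expand cl w H Z l (insert e C) := by
  induction l generalizing C with
  | nil => rfl
  | cons f l ih =>
    have he' := he
    rw [union_list_cons] at he'
    have h1 : expand cl w (insert e H) (fun C => Z (insert e C)) l C =
        expand cl w H Z l (insert e C) :=
      ih (mt (mem_mono (Set.subset_insert _ _)) he')
    have h2 : expand cl w (insert e H) (fun C => Z (insert e C)) l (insert f C) =
        expand cl w H Z l (insert f (insert e C)) := by
      rw [Set.insert_comm]
      exact ih (by rwa [Set.insert_union])
    have h3 : f ∈ cl (insert e C) ↔ f ∈ cl C := hx.mem_insert_iff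
      (Set.subset_union_left.trans (Set.subset_insert _ _)) he'
      (mem_of_mem (Set.mem_insert _ _))
    have h4 : C ∪ ({g | g ∈ l} ∪ insert e H) = insert e C ∪ ({g | g ∈ l} ∪ H) := by
      ext; simp; tauto
    simp only [expand, h1, h2]
    exact if_congr h3.symm rfl (if_congr (by rw [h4]) rfl rfl)

end Expansion

/-! ### Contracting or deleting a zero edge in an expansion -/

section Pointed

open ClosureOperator TutteVar

variable {E A : Type*} [CommRing A] {cl : ClosureOperator (Set E)} {w : TutteVar → E → A}
  {H : Set E} {Z : Set E → A}

open scoped Classical in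
/-- Contracting the zero edge `e` instead of keeping it as a zero edge: only the terms in which `e`
does not become a loop correspond to each other, and the excess is a multiple of the sum of
the terms in which `e` becomes a loop. -/
theorem expand_contract_sub (hx : cl.Exchange) (hZc : ∀ C C', cl C = cl C' → Z C = Z C')
    {e : E} {a b : A} (l : List E)
    (hab : ∀ f ∈ l, a * (w Y f - w y f) = b * w x f) {C : Set E} (he : e ∉ cl C) :
    a * (expand cl w H Z l (insert e C) -
        expand cl w (insert e H) (fun C => if e ∈ cl C then 0 else Z (insert e C)) l C) =
      b * expand cl w (insert e H) (fun C => if e ∈ cl C then Z C else 0) l C := by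
  induction l generalizing C with
  | nil => simp [expand, he]
  | cons f l ih =>
    have hf := hab f (by simp)
    have ih := fun C he => @ih (fun f hf => hab f (by simp [hf])) C he
    have hS : insert e C ∪ ({g | g ∈ l} ∪ H) = C ∪ ({g | g ∈ l} ∪ insert e H) := by
      ext; simp; tauto
    by_cases h1 : f ∈ cl C
    · rw [expand_loop (mem_mono (Set.subset_insert _ _) h1), expand_loop h1, expand_loop h1]
      linear_combination w Y f * ih C he
    by_cases h2 : f ∈ cl (C ∪ ({g | g ∈ l} ∪ insert e H))
    swap
    · have he' : e ∉ cl (insert f C) := fun h => h2 (mem_mono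
        (by intro; simp; tauto) (hx _ _ _ h he))
      rw [expand_bridge (by rwa [hS]), expand_bridge h2, expand_bridge h2, Set.insert_comm]
      linear_combination w X f * ih _ he'
    by_cases h3 : f ∈ cl (insert e C)
    swap
    · have he' : e ∉ cl (insert f C) := fun h => h3 (hx _ _ _ h he)
      rw [expand_branch h3 (by rwa [hS]), expand_branch h1 h2, expand_branch h1 h2,
        Set.insert_comm]
      linear_combination w x f * ih _ he' + w y f * ih C he
    -- now `e` becomes a loop when `f` is contracted, and `f` when `e` is contracted
    have he' : e ∈ cl (insert f C) := hx _ _ _ h3 h1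
    rw [expand_loop h3, expand_branch h1 h2, expand_branch h1 h2,
      expand_eq_zero l (C := insert f C) fun C' h _ => if_pos (mem_mono h he')]
    have h4 : expand cl w (insert e H) (fun C => if e ∈ cl C then Z C else 0) l (insert f C) =
        expand cl w H Z l (insert e C) := by
      rw [expand_congr (Z' := Z) l fun C' h _ => if_pos (mem_mono h he'),
        expand_congr_closure hZc l (hx.closure_insert_eq h3 h1)]
      refine expand_zero_loop l (mem_of_mem (Set.mem_insert _ _))
    rw [h4]
    linear_combination w y f * ih C he + expand cl w H Z l (insert e C) * hf

open scoped Classical in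
/-- Deleting the zero edge `e` instead of keeping it as a zero edge: only the terms in which `e`
does not become a bridge correspond to each other, and the excess is a multiple of the sum of
the terms in which `e` becomes a bridge. -/
theorem expand_delete_sub (hx : cl.Exchange)
    (hZ : ∀ C f g, f ∉ cl (C ∪ H) → g ∉ cl (C ∪ H) → f ∈ cl (insert g (C ∪ H)) →
      Z (insert f C) = Z (insert g C))
    {e : E} {a b : A} (l : List E)
    (hab : ∀ f ∈ l, a * (w X f - w x f) = b * w y f) {C : Set E}
    (he : e ∈ cl (C ∪ ({g | g ∈ l} ∪ H))) :
    a * (expand cl w H Z l C -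
        expand cl w (insert e H) (fun C => if e ∈ cl (C ∪ H) then Z C else 0) l C) =
      b * expand cl w (insert e H)
        (fun C => if e ∈ cl (C ∪ H) then 0 else Z (insert e C)) l C := by
  induction l generalizing C with
  | nil =>
    have he' : e ∈ cl (C ∪ H) := by simpa using he
    simp [expand, he']
  | cons f l ih =>
    have hf := hab f (by simp)
    have ih := fun C he => @ih (fun f hf => hab f (by simp [hf])) C he
    rw [union_list_cons] at he
    have heC : e ∈ cl (insert f C ∪ ({g | g ∈ l} ∪ H)) := by rwa [Set.insert_union]
    have hS : C ∪ ({g | g ∈ l} ∪ insert e H) = insert e (C ∪ ({g | g ∈ l} ∪ H)) := by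
      ext; simp
    by_cases h1 : f ∈ cl C
    · have he' : e ∈ cl (C ∪ ({g | g ∈ l} ∪ H)) := by
        rwa [closure_insert (mem_mono Set.subset_union_left h1)] at he
      rw [expand_loop h1, expand_loop h1, expand_loop h1]
      linear_combination w Y f * ih C he'
    by_cases h2 : f ∈ cl (C ∪ ({g | g ∈ l} ∪ insert e H))
    swap
    · have h3 : f ∉ cl (C ∪ ({g | g ∈ l} ∪ H)) := by
        rw [hS] at h2
        exact mt (mem_mono (Set.subset_insert _ _)) h2
      rw [expand_bridge h3, expand_bridge h2, expand_bridge h2]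
      linear_combination w X f * ih _ heC
    rw [expand_branch h1 h2, expand_branch h1 h2]
    rw [hS] at h2
    by_cases h3 : f ∈ cl (C ∪ ({g | g ∈ l} ∪ H))
    · have he' : e ∈ cl (C ∪ ({g | g ∈ l} ∪ H)) := by rwa [closure_insert h3] at he
      rw [expand_branch h1 h3]
      linear_combination w x f * ih _ heC + w y f * ih C he'
    -- now `e` becomes a bridge when `f` is deleted, and `f` when `e` is deleted
    have he' : e ∉ cl (C ∪ ({g | g ∈ l} ∪ H)) := fun h => h3 (by rwa [closure_insert h] at h2)
    have hsub : ∀ C', C' ⊆ C ∪ {g | g ∈ l} → e ∉ cl (C' ∪ H) := fun C' h h' =>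
      he' (mem_mono (by rw [← Set.union_assoc]; exact Set.union_subset_union_left _ h) h')
    rw [expand_bridge h3, expand_eq_zero l (C := C) fun C' _ h => if_neg (hsub C' h)]
    have h4 : expand cl w (insert e H) (fun C => if e ∈ cl (C ∪ H) then 0 else Z (insert e C)) l C =
        expand cl w H Z l (insert f C) := by
      rw [expand_congr (Z' := fun C => Z (insert e C)) l fun C' _ h => if_neg (hsub C' h),
        expand_contract_bridge hx l he', expand_series hx hZ l h3 he' h2]
    rw [h4]
    linear_combination w x f * ih _ heC + expand cl w H Z l (insert f C) * hf

end Pointed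

/-! ### The closure operator of a colored graph -/

namespace ColoredGraph

variable {K : Type v} {G : ColoredGraph.{u} K}

theorem conn_ends_congr {S : Set G.E} {f : G.E} {a b c d : G.V} (h : G.ends f = s(a, b))
    (h' : G.ends f = s(c, d)) : G.conn S a b ↔ G.conn S c d := by
  rw [h] at h'
  rcases Sym2.eq_iff.1 h' with ⟨rfl, rfl⟩ | ⟨rfl, rfl⟩
  · rfl
  · exact ⟨fun h => Setoid.symm' _ h, fun h => Setoid.symm' _ h⟩

/-- The closure operator of the cycle matroid of a graph: the closure of `S` consists of the edges
whose endpoints are joined by a walk in `S`. -/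
def closure (G : ColoredGraph.{u} K) : ClosureOperator (Set G.E) :=
  ClosureOperator.mk' (fun S => {f | ∀ a b, G.ends f = s(a, b) → G.conn S a b})
    (fun _ _ h _ hf a b e => conn_mono h (hf a b e)) (fun _ _ hf _ _ e => conn_of_ends hf e)
    (fun S _ hf a b e => conn_rec (G.conn S) id
      (fun _ (hg : ∀ a b, _ → G.conn S a b) c d e => hg c d e) (hf a b e))

theorem mem_closure {S : Set G.E} {f : G.E} {a b : G.V} (h : G.ends f = s(a, b)) :
    f ∈ G.closure S ↔ G.conn S a b :=
  ⟨fun hf => hf a b h, fun hab _ _ h' => (conn_ends_congr h h').1 hab⟩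

theorem conn_closure {S : Set G.E} {a b : G.V} : G.conn (G.closure S) a b ↔ G.conn S a b :=
  ⟨fun h => conn_rec (G.conn S) id (fun _ hg _ _ e => (mem_closure e).1 hg) h,
    fun h => conn_mono (G.closure.le_closure S) h⟩

theorem conn_eq_of_closure_eq {S T : Set G.E} (h : G.closure S = G.closure T) :
    G.conn S = G.conn T :=
  Setoid.ext fun a b => by rw [← conn_closure, h, conn_closure]

/-- Adding an edge joins at most two components. -/
theorem conn_insert {S : Set G.E} {g : G.E} {p q a b : G.V} (h : G.ends g = s(p, q)) :
    G.conn (insert g S) a b ↔ G.conn S a b ∨ (G.conn S a p ∧ G.conn S q b) ∨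
      (G.conn S a q ∧ G.conn S p b) := by
  have refl : ∀ a, G.conn S a a := fun a => Setoid.refl' _ a
  have symm : ∀ {a b}, G.conn S a b → G.conn S b a := fun h => Setoid.symm' _ h
  have trans : ∀ {a b c}, G.conn S a b → G.conn S b c → G.conn S a c :=
    fun h h' => Setoid.trans' _ h h'
  constructor
  · intro hab
    induction hab with
    | rel a b hab =>
      obtain ⟨f, rfl | hf, e⟩ := hab
      · rw [h] at e
        rcases Sym2.eq_iff.1 e with ⟨rfl, rfl⟩ | ⟨rfl, rfl⟩
        · exact Or.inr (Or.inl ⟨refl _, refl _⟩)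
        · exact Or.inr (Or.inr ⟨refl _, refl _⟩)
      · exact Or.inl (conn_of_ends hf e)
    | refl a => exact Or.inl (refl a)
    | symm a b _ ih =>
      rcases ih with h | ⟨h, h'⟩ | ⟨h, h'⟩
      · exact Or.inl (symm h)
      · exact Or.inr (Or.inr ⟨symm h', symm h⟩)
      · exact Or.inr (Or.inl ⟨symm h', symm h⟩)
    | trans a b c _ _ ih₁ ih₂ =>
      rcases ih₁ with h | ⟨h, h'⟩ | ⟨h, h'⟩ <;> rcases ih₂ with k | ⟨k, k'⟩ | ⟨k, k'⟩
      · exact Or.inl (trans h k)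
      · exact Or.inr (Or.inl ⟨trans h k, k'⟩)
      · exact Or.inr (Or.inr ⟨trans h k, k'⟩)
      · exact Or.inr (Or.inl ⟨h, trans h' k⟩)
      · exact Or.inr (Or.inl ⟨h, k'⟩)
      · exact Or.inl (trans h k')
      · exact Or.inr (Or.inr ⟨h, trans h' k⟩)
      · exact Or.inl (trans h k')
      · exact Or.inr (Or.inr ⟨h, k'⟩)
  · have hpq : G.conn (insert g S) p q := conn_of_ends (Set.mem_insert _ _) h
    have mono : ∀ {a b}, G.conn S a b → G.conn (insert g S) a b :=
      fun h => conn_mono (Set.subset_insert _ _) h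
    rintro (h | ⟨h, h'⟩ | ⟨h, h'⟩)
    · exact mono h
    · exact Setoid.trans' _ (mono h) (Setoid.trans' _ hpq (mono h'))
    · exact Setoid.trans' _ (mono h) (Setoid.trans' _ (Setoid.symm' _ hpq) (mono h'))

theorem closure_exchange (G : ColoredGraph.{u} K) : G.closure.Exchange := by
  intro S f g hf hf'
  obtain ⟨a, b, hab⟩ := G.exists_ends f
  obtain ⟨p, q, hpq⟩ := G.exists_ends g
  rw [mem_closure hab] at hf hf'
  rw [mem_closure hpq]
  rcases (conn_insert hpq).1 hf with h | ⟨h, h'⟩ | ⟨h, h'⟩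
  · exact absurd h hf'
  · exact (conn_insert hab).2 (Or.inr (Or.inl ⟨Setoid.symm' _ h, Setoid.symm' _ h'⟩))
  · exact (conn_insert hab).2 (Or.inr (Or.inr ⟨h', h⟩))

theorem isLoop_iff {f : G.E} : G.IsLoop f ↔ f ∈ G.closure ∅ := by
  obtain ⟨a, b, h⟩ := G.exists_ends f
  rw [mem_closure h, IsLoop, h, Sym2.mk_isDiag_iff]
  refine ⟨fun h => h ▸ Setoid.refl' _ _, fun h => ?_⟩
  exact conn_rec ⊥ id (fun _ h => absurd h (Set.notMem_empty _)) h

theorem isBridge_iff {f : G.E} : G.IsBridge f ↔ f ∉ G.closure {f}ᶜ := by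
  obtain ⟨a, b, h⟩ := G.exists_ends f
  rw [mem_closure h]
  exact ⟨fun hf => hf a b h, fun hf c d h' => mt (conn_ends_congr h h').2 hf⟩

/-! ### Cycles, cocycles and the closure operator -/

open Fin.NatCast Fin.CommRing in
/-- Every edge of a cycle is spanned by the others: walk around the cycle. -/
theorem IsCycle.mem_closure_diff {Z : Set G.E} (hZ : G.IsCycle Z) {f : G.E} (hf : f ∈ Z) :
    f ∈ G.closure (Z \ {f}) := by
  obtain ⟨n, v, f, -, hf_inj, he, rfl⟩ := hZ
  obtain ⟨j, rfl⟩ := hf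
  rw [mem_closure (he j)]
  have key : ∀ k : ℕ, k ≤ n →
      G.conn (Set.range f \ {f j}) (v (j + 1)) (v (j + 1 + (k : Fin (n + 1)))) := by
    intro k hk
    induction k with
    | zero => simp
    | succ k ih =>
      have hne : f (j + 1 + k) ≠ f j := by
        intro h
        have h := hf_inj h
        rw [show j + 1 + (k : Fin (n + 1)) = j + ((k + 1 : ℕ) : Fin (n + 1)) by push_cast; ring,
          add_eq_left, Fin.natCast_eq_zero] at h
        exact absurd (Nat.le_of_dvd (by omega) h) (by omega)
      have hends : G.ends (f (j + 1 + k)) = s(v (j + 1 + k), v (j + 1 + (k + 1 : ℕ))) := by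
        rw [he]
        push_cast
        rw [add_assoc (j + 1)]
      exact Setoid.trans' _ (ih (by omega)) 
        (conn_of_ends (S := Set.range f \ {f j}) ⟨⟨_, rfl⟩, hne⟩ hends)
  have h := key n le_rfl
  have h1 : j + 1 + (n : Fin (n + 1)) = j := by
    have : ((n + 1 : ℕ) : Fin (n + 1)) = 0 := by simp
    push_cast at this
    rw [add_assoc, add_comm 1, this, add_zero]
  rw [h1] at h
  exact Setoid.symm' _ h

/-- An edge spanned by `S` is closed to a cycle by a path in `S`. -/
theorem exists_isCycle {S : Set G.E} {f : G.E} (hf : f ∉ S) (h : f ∈ G.closure S) :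
    ∃ Z, G.IsCycle Z ∧ Z ⊆ insert f S ∧ f ∈ Z := by
  obtain ⟨a, b, hab⟩ := G.exists_ends f
  rw [mem_closure hab] at h
  let Γ : SimpleGraph G.V := SimpleGraph.fromRel fun a b => ∃ g ∈ S, G.ends g = s(a, b)
  have hΓ : Γ.Reachable a b := by
    refine conn_rec Γ.reachableSetoid id ?_ h
    intro g hg c d e
    by_cases hcd : c = d
    · subst hcd
      exact SimpleGraph.Reachable.refl _
    · exact SimpleGraph.Adj.reachable ((SimpleGraph.fromRel_adj _ _ _).2 ⟨hcd, Or.inl ⟨g, hg, e⟩⟩)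
  obtain ⟨p, hp⟩ := hΓ.exists_isPath
  have hadj : ∀ i, i < p.length → ∃ g ∈ S, G.ends g = s(p.getVert i, p.getVert (i + 1)) := by
    intro i hi
    rcases ((SimpleGraph.fromRel_adj _ _ _).1 (p.adj_getVert_succ hi)).2 with h | ⟨g, hg, e⟩
    · exact h
    · exact ⟨g, hg, e.trans Sym2.eq_swap⟩
  have : Nonempty G.E := ⟨f⟩
  choose! c hcS hc using hadj
  have hinj := hp.getVert_injOn
  -- the path `v 0, …, v p.length`, closed by `f` as the edge with the last index
  refine ⟨Set.range fun i : Fin (p.length + 1) => if (i : ℕ) < p.length then c i else f,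
    ⟨p.length, fun i => p.getVert i, _, ?_, ?_, ?_, rfl⟩, ?_, ?_⟩
  · intro i j hij
    exact Fin.ext (hinj (Nat.lt_succ_iff.1 i.2) (Nat.lt_succ_iff.1 j.2) hij)
  · intro i j hij
    dsimp only at hij
    have hi := i.2
    have hj := j.2
    split_ifs at hij with h1 h2 h2
    · have h3 := hc _ h1
      rw [hij, hc _ h2] at h3
      apply Fin.ext
      rcases Sym2.eq_iff.1 h3 with ⟨h4, -⟩ | ⟨h4, h5⟩
      · exact (hinj (by simpa using h2.le) (by simpa using h1.le) h4).symm
      · have h6 := hinj (by simpa using h2.le) (by simpa using h1) h4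
        have h7 := hinj (by simpa using h2) (by simpa using h1.le) h5
        omega
    · exact absurd (hij ▸ hcS _ h1) hf
    · exact absurd (hij ▸ hcS _ h2) hf
    · exact Fin.ext (by omega)
  · intro i
    dsimp only
    split_ifs with h1
    · rw [hc _ h1, Fin.val_add_one_of_lt (by rw [Fin.lt_def]; simpa using h1)]
    · have hi : i = Fin.last _ := Fin.ext (by have := i.2; simp; omega)
      subst hi
      simp [hab, Sym2.eq_swap]
  · rintro _ ⟨i, rfl⟩
    dsimp only
    split_ifs with h1
    · exact Or.inr (hcS _ h1)
    · exact Or.inl rfl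
  · exact ⟨Fin.last _, by simp⟩

theorem IsCocycle.notMem_closure_compl {Z : Set G.E} (hZ : G.IsCocycle Z) {f : G.E} (hf : f ∈ Z) :
    f ∉ G.closure Zᶜ := by
  intro h
  obtain ⟨a, b, h1, h2⟩ := hZ.prop
  have hsep : G.Separates (Z \ {f}) := by
    refine ⟨a, b, h1, fun h3 => h2 ?_⟩
    have : (Z \ {f})ᶜ = insert f Zᶜ := by
      ext g; simp only [Set.mem_compl_iff, Set.mem_sdiff, Set.mem_singleton_iff,
        Set.mem_insert_iff]
      tauto
    rw [this, ← conn_closure, ClosureOperator.closure_insert h, conn_closure] at h3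
    exact h3
  exact (hZ.le_of_le hsep Set.sdiff_subset hf).2 rfl

/-- The complement of a maximal set containing `Wᶜ` that does not span `f` (a hyperplane of the
cycle matroid) is a cocycle. -/
theorem exists_isCocycle {W : Set G.E} {f : G.E} (h : f ∉ G.closure Wᶜ) :
    ∃ Z, G.IsCocycle Z ∧ Z ⊆ W ∧ f ∈ Z := by
  have := G.finite_E
  obtain ⟨T, hWT, hT⟩ := (Set.toFinite {T | f ∉ G.closure T}).exists_le_maximal h
  have hfT : f ∉ T := fun h => hT.prop (ClosureOperator.mem_of_mem h)
  have hspan : ∀ g ∉ T, f ∈ G.closure (insert g T) := fun g hg => by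
    by_contra h'
    exact hg (hT.le_of_ge h' (Set.subset_insert _ _) (Set.mem_insert _ _))
  have htop : ∀ g, g ∈ G.closure (insert f T) := fun g => by
    by_cases hg : g ∈ T
    · exact ClosureOperator.mem_of_mem (Set.mem_insert_of_mem _ hg)
    · exact G.closure_exchange _ _ _ (hspan g hg) hT.prop
  refine ⟨Tᶜ, ⟨?_, ?_⟩, Set.compl_subset_comm.1 hWT, hfT⟩
  · obtain ⟨a, b, hab⟩ := G.exists_ends f
    refine ⟨a, b, conn_of_ends (Set.mem_univ f) hab, ?_⟩
    rw [compl_compl, ← mem_closure hab]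
    exact hT.prop
  · rintro Z ⟨a, b, h1, h2⟩ hZ g hg
    by_contra hgZ
    apply h2
    have hTZ : T ⊆ Zᶜ := Set.subset_compl_comm.1 hZ
    have hfZ : f ∈ G.closure Zᶜ := ClosureOperator.mem_mono (Set.insert_subset hgZ hTZ) (hspan g hg)
    rw [← conn_closure]
    refine conn_mono (fun k _ => ?_) h1
    rw [← ClosureOperator.closure_insert hfZ]
    exact ClosureOperator.mem_mono (Set.insert_subset_insert hTZ) (htop k)

end ColoredGraph

/-! ### The expansion as a sum over subsets -/

section ExpansionSum

open TutteVar

variable {E A : Type*} [CommRing A] (cl : ClosureOperator (Set E)) (w : TutteVar → E → A)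
  (H : Set E)

open scoped Classical in
/-- The coefficient in the deletion-contraction expansion of the term in which, among the edges of
the list, exactly those of `B` are contracted. -/
noncomputable def expandCoeff (B : Set E) : List E → Set E → A
  | [], _ => 1
  | f :: l, C =>
    if f ∈ B then
      (if f ∈ cl C then 0 else if f ∈ cl (C ∪ ({g | g ∈ l} ∪ H)) then w x f else w X f) *
        expandCoeff B l (insert f C)
    else
      (if f ∈ cl C then w Y f else if f ∈ cl (C ∪ ({g | g ∈ l} ∪ H)) then w y f else 0) *
        expandCoeff B l C

variable {cl w H}

theorem expandCoeff_congr {B B' : Set E} (l : List E) (h : ∀ g ∈ l, g ∈ B ↔ g ∈ B') (C : Set E) :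
    expandCoeff cl w H B l C = expandCoeff cl w H B' l C := by
  induction l generalizing C with
  | nil => rfl
  | cons f l ih =>
    have ih := ih fun g hg => h g (List.mem_cons_of_mem _ hg)
    have hf := h f List.mem_cons_self
    by_cases hB : f ∈ B
    · rw [expandCoeff, expandCoeff, if_pos hB, if_pos (hf.1 hB), ih]
    · rw [expandCoeff, expandCoeff, if_neg hB, if_neg (mt hf.2 hB), ih]

open scoped Classical in
theorem expand_eq_sum {Z : Set E → A} (l : List E) (hl : l.Nodup) (C : Set E) :
    expand cl w H Z l C =
      ∑ B ∈ l.toFinset.powerset, expandCoeff cl w H B l C * Z (C ∪ B) := by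
  induction l generalizing C with
  | nil => simp [expand, expandCoeff]
  | cons f l ih =>
    have hfl : f ∉ l := (List.nodup_cons.1 hl).1
    rw [List.toFinset_cons, Finset.sum_powerset_insert (by simpa using hfl)]
    have h1 : ∑ B ∈ l.toFinset.powerset, expandCoeff cl w H B (f :: l) C * Z (C ∪ B) =
        (if f ∈ cl C then w Y f else if f ∈ cl (C ∪ ({g | g ∈ l} ∪ H)) then w y f else 0) *
          expand cl w H Z l C := by
      rw [ih (List.nodup_cons.1 hl).2, Finset.mul_sum]
      refine Finset.sum_congr rfl fun B hB => ?_
      have hfB : f ∉ (B : Set E) := fun h =>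
        hfl (List.mem_toFinset.1 (Finset.mem_powerset.1 hB (Finset.mem_coe.1 h)))
      rw [expandCoeff, if_neg hfB, mul_assoc]
    have h2 : ∑ B ∈ l.toFinset.powerset, expandCoeff cl w H ↑(insert f B) (f :: l) C *
          Z (C ∪ ↑(insert f B)) =
        (if f ∈ cl C then 0 else if f ∈ cl (C ∪ ({g | g ∈ l} ∪ H)) then w x f else w X f) *
          expand cl w H Z l (insert f C) := by
      rw [ih (List.nodup_cons.1 hl).2, Finset.mul_sum]
      refine Finset.sum_congr rfl fun B hB => ?_
      rw [expandCoeff, if_pos (by simp), mul_assoc, Finset.coe_insert, Set.union_insert,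
        Set.insert_union, expandCoeff_congr (B := insert f ↑B) (B' := ↑B)]
      intro g hg
      have : g ≠ f := fun h => hfl (h ▸ hg)
      simp [this]
    rw [h1, h2, expand]
    split_ifs <;> ring

end ExpansionSum

namespace ColoredGraph

/-! ### Contracting sets and activities in terms of closures -/

section Activity

variable {K : Type v} {G : ColoredGraph.{u} K} {H B : Set G.E} {φ : G.E → ℕ}

/-- The edges of `B` with a larger label than `f`. -/
def above (φ : G.E → ℕ) (B : Set G.E) (f : G.E) : Set G.E := {g | g ∈ B ∧ φ f < φ g}

/-- The edges outside `H` with a smaller label than `f`. -/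
def below (φ : G.E → ℕ) (H : Set G.E) (f : G.E) : Set G.E := {g | g ∉ H ∧ φ g < φ f}

theorem IsProperLabeling.lt_or_lt (hφ : G.IsProperLabeling H φ) {f g : G.E} (hf : f ∉ H)
    (hg : g ∉ H) (hfg : f ≠ g) : φ f < φ g ∨ φ g < φ f :=
  lt_or_gt_of_ne fun h => hfg (hφ.2 hf hg h)

/-- An edge is internally active if it is a bridge once the edges with larger labels have been
processed. -/
theorem internallyActive_iff (hφ : G.IsProperLabeling H φ) (hB : B ⊆ Hᶜ) {f : G.E} (hf : f ∈ B) :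
    G.InternallyActive H φ B f ↔ f ∉ G.closure (above φ B f ∪ (below φ H f ∪ H)) := by
  constructor
  · rintro ⟨Z, hZ, hZB, hfZ, hmin⟩
    refine mt (ClosureOperator.mem_mono ?_) (hZ.notMem_closure_compl hfZ)
    rintro g (⟨h1, h2⟩ | ⟨h1, h2⟩ | h1) hg
    · rcases hZB hg with rfl | h3
      · exact lt_irrefl _ h2
      · exact h3 (Or.inl h1)
    · exact absurd (hmin g hg) (not_le.2 h2)
    · rcases hZB hg with rfl | h3
      · exact hB hf h1
      · exact h3 (Or.inr h1)
  · intro h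
    have hW : (insert f {g | g ∉ B ∪ H ∧ φ f < φ g})ᶜ ⊆ above φ B f ∪ (below φ H f ∪ H) := by
      intro g hg
      have h1 : g ≠ f := fun h => hg (Or.inl h)
      have h2 : g ∈ B ∪ H ∨ ¬ φ f < φ g := by
        by_contra! h3
        exact hg (Or.inr h3)
      by_cases hgH : g ∈ H
      · exact Or.inr (Or.inr hgH)
      rcases hφ.lt_or_lt (hB hf) hgH h1.symm with h3 | h3
      · rcases h2 with (h2 | h2) | h2
        · exact Or.inl ⟨h2, h3⟩
        · exact absurd h2 hgH
        · exact absurd h3 h2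
      · exact Or.inr (Or.inl ⟨hgH, h3⟩)
    obtain ⟨Z, hZ, hZW, hfZ⟩ := exists_isCocycle (mt (ClosureOperator.mem_mono hW) h)
    refine ⟨Z, hZ, hZW.trans (Set.insert_subset_insert fun g hg => hg.1), hfZ, fun g hg => ?_⟩
    rcases hZW hg with rfl | h1
    · exact le_rfl
    · exact h1.2.le

/-- An edge is externally active if it is a loop once the edges with larger labels have been
processed. -/
theorem externallyActive_iff (hφ : G.IsProperLabeling H φ) (hB : B ⊆ Hᶜ) {f : G.E} (hfH : f ∉ H) :
    G.ExternallyActive φ B f ↔ f ∈ G.closure (above φ B f) := by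
  constructor
  · rintro ⟨Z, hZ, hZB, hfZ, hmin⟩
    refine ClosureOperator.mem_mono ?_ (hZ.mem_closure_diff hfZ)
    rintro g ⟨hg, hgf⟩
    have hgB : g ∈ B := (hZB hg).resolve_left hgf
    exact ⟨hgB, (hmin g hg).lt_of_ne fun h => hgf (hφ.2 hfH (hB hgB) h).symm⟩
  · intro h
    obtain ⟨Z, hZ, hZS, hfZ⟩ := exists_isCycle (fun h => lt_irrefl _ h.2) h
    refine ⟨Z, hZ, hZS.trans (Set.insert_subset_insert fun g hg => hg.1), hfZ, fun g hg => ?_⟩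
    rcases hZS hg with rfl | h1
    · exact le_rfl
    · exact h1.2.le

/-- A set of edges outside `H` is contracting if the edges can be processed in decreasing order of
their labels without ever contracting a loop or deleting a bridge. -/
theorem isContracting_iff (hφ : G.IsProperLabeling H φ) (hB : B ⊆ Hᶜ) :
    G.IsContracting H B ↔ ∀ f ∉ H, (f ∈ B → f ∉ G.closure (above φ B f)) ∧
      (f ∉ B → f ∈ G.closure (above φ B f ∪ (below φ H f ∪ H))) := by
  have := G.finite_E
  constructor
  · rintro ⟨-, hcyc, hcocyc⟩ f hfH
    refine ⟨fun hfB h => ?_, fun hfB => by_contra fun h => ?_⟩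
    · obtain ⟨Z, hZ, hZS, -⟩ := exists_isCycle (fun h => lt_irrefl _ h.2) h
      exact hcyc Z hZ (hZS.trans (Set.insert_subset hfB fun g hg => hg.1))
    · rw [← compl_compl (above φ B f ∪ (below φ H f ∪ H))] at h
      obtain ⟨Z, hZ, hZS, -⟩ := exists_isCocycle h
      refine hcocyc Z hZ (hZS.trans (Set.compl_subset_compl.2 (Set.union_subset ?_ ?_)))
      · intro g hg
        rcases hφ.lt_or_lt hfH (hB hg) (fun h => hfB (h ▸ hg)) with h1 | h1
        · exact Or.inl ⟨hg, h1⟩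
        · exact Or.inr (Or.inl ⟨hB hg, h1⟩)
      · exact fun g hg => Or.inr (Or.inr hg)
  · intro h
    refine ⟨hB, fun Z hZ hZB => ?_, fun Z hZ hZB => ?_⟩
    · have hne : Z.Nonempty := by
        obtain ⟨n, v, f, -, -, -, rfl⟩ := hZ
        exact ⟨f 0, 0, rfl⟩
      -- the edge with the smallest label would be a loop when it is contracted
      obtain ⟨f, hfZ, hmin⟩ := Set.exists_min_image Z φ Z.toFinite hne
      refine (h f (hB (hZB hfZ))).1 (hZB hfZ)
        (ClosureOperator.mem_mono ?_ (hZ.mem_closure_diff hfZ))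
      rintro g ⟨hg, hgf⟩
      exact ⟨hZB hg, (hmin g hg).lt_of_ne fun h => hgf (hφ.2 (hB (hZB hfZ)) (hB (hZB hg)) h).symm⟩
    · have hne : Z.Nonempty := by
        rw [Set.nonempty_iff_ne_empty]
        rintro rfl
        obtain ⟨a, b, h1, h2⟩ := hZ.prop
        exact h2 (by rwa [Set.compl_empty])
      -- the edge with the smallest label would be a bridge when it is deleted
      obtain ⟨f, hfZ, hmin⟩ := Set.exists_min_image Z φ Z.toFinite hne
      refine hZ.notMem_closure_compl hfZ (ClosureOperator.mem_mono ?_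
        ((h f fun h => hZB hfZ (Or.inr h)).2 fun h => hZB hfZ (Or.inl h)))
      rintro g (⟨h1, -⟩ | ⟨h1, h2⟩ | h1) hg
      · exact hZB hg (Or.inl h1)
      · exact absurd (hmin g hg) (not_le.2 h2)
      · exact hZB hg (Or.inr h1)

end Activity

/-! ### The relative Tutte polynomial as an expansion -/

section RelTutte

variable (R : Type*) [CommRing R] {Λ₁ : Type*} {Λ₀ : Type v}

/-- The variable `x`, `X`, `y` or `Y` of the color of an edge (and `1` for a zero edge). -/
noncomputable def edgeVar (G : ColoredGraph.{u} (Λ₁ ⊕ Λ₀)) (t : TutteVar) (f : G.E) :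
    TutteRing R Λ₁ :=
  match G.color f with
  | Sum.inr _ => 1
  | Sum.inl l => t.elt R l

variable {G : ColoredGraph.{u} (Λ₁ ⊕ Λ₀)} {φ : G.E → ℕ}

theorem exists_color_of_notMem {f : G.E} (hf : f ∉ G.zeroEdges) : ∃ l, G.color f = Sum.inl l := by
  cases h : G.color f with
  | inl l => exact ⟨l, rfl⟩
  | inr l => exact absurd (by simp [zeroEdges, h]) hf

/-- A list of the regular edges in decreasing order of their labels. -/
structure IsRegularList (G : ColoredGraph.{u} (Λ₁ ⊕ Λ₀)) (φ : G.E → ℕ) (l : List G.E) : Prop where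
  mem_iff : ∀ f, f ∈ l ↔ f ∉ G.zeroEdges
  sorted : l.Pairwise fun f g => φ g < φ f

theorem IsRegularList.nodup {l : List G.E} (hl : G.IsRegularList φ l) : l.Nodup :=
  hl.sorted.imp fun h h' => by simp [h'] at h

theorem exists_isRegularList (hφ : G.IsProperLabeling G.zeroEdges φ) :
    ∃ l, G.IsRegularList φ l := by
  classical
  have := G.finite_E
  let s := (Set.toFinite G.zeroEdgesᶜ).toFinset
  let r : G.E → G.E → Prop := fun f g => φ g ≤ φ f
  have : Std.Total r := ⟨fun f g => le_total _ _⟩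
  have : IsTrans G.E r := ⟨fun f g h h1 h2 => le_trans h2 h1⟩
  have hmem : ∀ f, f ∈ s.toList.insertionSort r ↔ f ∉ G.zeroEdges := by
    intro f
    rw [(List.perm_insertionSort r _).mem_iff]
    simp [s]
  refine ⟨s.toList.insertionSort r, hmem, ?_⟩
  have hnodup : (s.toList.insertionSort r).Nodup :=
    (List.perm_insertionSort r _).nodup_iff.2 s.nodup_toList
  refine ((List.pairwise_insertionSort r s.toList).and hnodup).imp_of_mem ?_
  rintro f g hf hg ⟨h1, h2⟩
  exact lt_of_le_of_ne h1 fun h => h2 (hφ.2 ((hmem f).1 hf) ((hmem g).1 hg) h.symm)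

open scoped Classical in
/-- For a final segment `l` of the decreasing list of all regular edges, the coefficient of `B` in
the expansion that starts with the contraction of the earlier edges of `B` is the product of the
weights of the edges of `l`, or zero if a loop would be contracted or a bridge deleted. -/
theorem expandCoeff_eq_prod (hφ : G.IsProperLabeling G.zeroEdges φ) {B : Set G.E}
    (hB : B ⊆ G.zeroEdgesᶜ) (l : List G.E) (hsorted : l.Pairwise fun f g => φ g < φ f)
    (hreg : ∀ f ∈ l, f ∉ G.zeroEdges)
    (hfinal : ∀ f ∈ l, ∀ g ∉ G.zeroEdges, g ∉ l → φ f < φ g) :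
    expandCoeff G.closure (G.edgeVar R) G.zeroEdges B l {g | g ∈ B ∧ g ∉ l} =
      if ∀ f ∈ l, (f ∈ B → f ∉ G.closure (above φ B f)) ∧
        (f ∉ B → f ∈ G.closure (above φ B f ∪ (below φ G.zeroEdges f ∪ G.zeroEdges)))
      then (l.map (G.weight R φ B)).prod else 0 := by
  induction l with
  | nil => simp [expandCoeff]
  | cons f l ih =>
    obtain ⟨hfl, hsorted⟩ := List.pairwise_cons.1 hsorted
    have hfH := hreg f List.mem_cons_self
    have hnot : f ∉ l := fun h => lt_irrefl _ (hfl f h)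
    have ih := ih hsorted (fun g hg => hreg g (List.mem_cons_of_mem _ hg)) fun g hg k hk hkl => by
      by_cases hkf : k = f
      · exact hkf ▸ hfl g hg
      · exact hfinal g (List.mem_cons_of_mem _ hg) k hk (by simp [hkf, hkl])
    have habove : {g | g ∈ B ∧ g ∉ f :: l} = above φ B f := by
      ext g
      refine and_congr_right fun hgB => ⟨fun h => hfinal f List.mem_cons_self g (hB hgB) h, ?_⟩
      rintro h hg
      rcases List.mem_cons.1 hg with rfl | hg
      · exact lt_irrefl _ h
      · exact lt_asymm h (hfl g hg)
    have hbelow : {g | g ∈ l} = below φ G.zeroEdges f := by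
      ext g
      refine ⟨fun h => ⟨hreg g (List.mem_cons_of_mem _ h), hfl g h⟩, fun ⟨h1, h2⟩ => ?_⟩
      by_contra h3
      refine lt_asymm h2 (hfinal f List.mem_cons_self g h1 ?_)
      rintro h4
      rcases List.mem_cons.1 h4 with rfl | h4
      · exact lt_irrefl _ h2
      · exact h3 h4
    obtain ⟨c, hc⟩ := exists_color_of_notMem hfH
    have hv : ∀ t, G.edgeVar R t f = t.elt R c := fun t => by simp [edgeVar, hc]
    rw [habove, expandCoeff, hbelow, List.map_cons, List.prod_cons]
    simp only [hv, List.forall_mem_cons]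
    by_cases hfB : f ∈ B
    · have hset : insert f (above φ B f) = {g | g ∈ B ∧ g ∉ l} := by
        rw [← habove]
        ext g
        by_cases hg : g = f
        · subst hg
          simp [hfB, hnot]
        · simp [hg]
      rw [if_pos hfB, hset, ih]
      have hw : G.weight R φ B f = if f ∈ G.closure (above φ B f ∪ (below φ G.zeroEdges f ∪
          G.zeroEdges)) then TutteVar.x.elt R c else TutteVar.X.elt R c := by
        simp only [weight, hc, if_pos hfB, internallyActive_iff hφ hB hfB, ite_not]
      rw [← hw]
      by_cases h1 : f ∈ G.closure (above φ B f)
      · simp [h1, hfB]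
      · simp [h1, hfB]
    · have hset : above φ B f = {g | g ∈ B ∧ g ∉ l} := by
        rw [← habove]
        ext g
        by_cases hg : g = f
        · subst hg
          simp [hfB]
        · simp [hg]
      rw [if_neg hfB]
      have hw : G.weight R φ B f = if f ∈ G.closure (above φ B f) then TutteVar.Y.elt R c
          else TutteVar.y.elt R c := by
        simp only [weight, hc, if_neg hfB, externallyActive_iff hφ hB hfH]
      have hih := ih
      rw [← hset] at hih
      rw [hih, hw]
      by_cases h1 : f ∈ G.closure (above φ B f)
      · have h2 : f ∈ G.closure (above φ B f ∪ (below φ G.zeroEdges f ∪ G.zeroEdges)) :=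
          ClosureOperator.mem_mono Set.subset_union_left h1
        simp [h1, h2, hfB]
      · by_cases h2 : f ∈ G.closure (above φ B f ∪ (below φ G.zeroEdges f ∪ G.zeroEdges))
        · simp [h1, h2, hfB]
        · simp [h1, h2, hfB]

theorem map_expandCoeff {E A B : Type*} [CommRing A] [CommRing B] (ψ : A →+* B)
    {cl : ClosureOperator (Set E)} {w : TutteVar → E → A} {H D : Set E} (l : List E) (C : Set E) :
    ψ (expandCoeff cl w H D l C) = expandCoeff cl (fun t f => ψ (w t f)) H D l C := by
  induction l generalizing C with
  | nil => simp [expandCoeff]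
  | cons f l ih =>
    simp only [expandCoeff]
    split_ifs <;> simp [ih]

/-- The variable of the color of an edge as an element of the pointed Tutte ring. -/
noncomputable def edgeCoeff (G : ColoredGraph.{u} (Λ₁ ⊕ Λ₀)) (t : TutteVar) (f : G.E) :
    PointedTutteRing.{u} R Λ₁ Λ₀ :=
  MvPolynomial.C (G.edgeVar R t f)

/-- The relative Tutte polynomial is the deletion-contraction expansion along the regular edges in
decreasing order of their labels: for the edge with the largest label, being active means being a
bridge or a loop. -/
theorem relTutte_eq_expand (hφ : G.IsProperLabeling G.zeroEdges φ) {l : List G.E}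
    (hl : G.IsRegularList φ l) :
    G.relTutte R φ = expand G.closure (G.edgeCoeff R) G.zeroEdges
      (fun C => MvPolynomial.X (G.terminal C).cls) l ∅ := by
  classical
  have := G.finite_E
  have := Fintype.ofFinite (Set G.E)
  have hlH : (l.toFinset : Set G.E) = G.zeroEdgesᶜ := by
    ext f
    simp [hl.mem_iff]
  have hprod : ∀ B, ∏ᶠ f ∈ G.zeroEdgesᶜ, G.weight R φ B f = (l.map (G.weight R φ B)).prod := by
    intro B
    rw [← hlH, finprod_mem_coe_finset, List.prod_toFinset _ hl.nodup]
  have hcoeff : ∀ B ⊆ G.zeroEdgesᶜ, expandCoeff G.closure (G.edgeCoeff R) G.zeroEdges B l ∅ =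
      if G.IsContracting G.zeroEdges B then
        (MvPolynomial.C (∏ᶠ f ∈ G.zeroEdgesᶜ, G.weight R φ B f) :
          PointedTutteRing.{u} R Λ₁ Λ₀) else 0 := by
    intro B hB
    have h := expandCoeff_eq_prod R hφ hB l hl.sorted (fun f hf => (hl.mem_iff f).1 hf)
      fun f _ g hg hgl => absurd ((hl.mem_iff g).2 hg) hgl
    have h0 : {g | g ∈ B ∧ g ∉ l} = ∅ := by
      ext g
      simpa [hl.mem_iff] using fun hg => hB hg
    rw [h0] at h
    have h2 := congrArg (MvPolynomial.C (σ := VP.{u} Λ₀)) h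
    refine (map_expandCoeff (MvPolynomial.C (σ := VP.{u} Λ₀)) l ∅).symm.trans (h2.trans ?_)
    rw [hprod, isContracting_iff hφ hB]
    simp only [hl.mem_iff]
    split_ifs <;> simp
  rw [relTutte, expand_eq_sum l hl.nodup]
  rw [finsum_mem_def, finsum_eq_sum_of_fintype]
  symm
  refine Finset.sum_of_injOn (fun B : Finset G.E => (B : Set G.E)) Finset.coe_injective.injOn
    (fun _ _ => Finset.mem_coe.2 (Finset.mem_univ _)) ?_ ?_
  · intro B _ hB
    refine Set.indicator_of_notMem (fun h => hB ?_) _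
    have hBH : B ⊆ G.zeroEdgesᶜ := (show G.IsContracting G.zeroEdges B from h).1
    refine ⟨(Set.toFinite B).toFinset, ?_, by simp⟩
    simp only [Finset.coe_powerset, Set.mem_preimage, Set.mem_powerset_iff, hlH]
    simpa using hBH
  · intro B hB
    have hBH : (B : Set G.E) ⊆ G.zeroEdgesᶜ := by
      rw [← hlH]
      exact_mod_cast Finset.mem_powerset.1 hB
    rw [hcoeff _ hBH, Set.empty_union]
    by_cases h : G.IsContracting G.zeroEdges B
    · rw [if_pos h, Set.indicator_of_mem (show (B : Set G.E) ∈ {C | G.IsContracting _ C} from h)]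
    · rw [if_neg h, zero_mul,
        Set.indicator_of_notMem (show (B : Set G.E) ∉ {C | G.IsContracting _ C} from h)]

end RelTutte

end ColoredGraph

/-! ### Minors, identification of vertices, and vertex pivots -/

namespace ColoredGraph

variable {K : Type v} {L : Type w}

/-- A minor depends on the contracted edges only through the partition of the vertices. -/
theorem cls_minor_congr {G : ColoredGraph.{u} K} {C C' S : Set G.E} {c : S → L}
    (h : G.conn C = G.conn C') : (G.minor C S c).cls = (G.minor C' S c).cls :=
  cls_eq_of_iso
    { onV := Quotient.congr (Equiv.refl _) fun a b => by
        change G.conn C a b ↔ G.conn C' a b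
        rw [h]
      onE := Equiv.refl _
      ends_eq := fun f => by
        change (G.ends f.1).map _ = ((G.ends f.1).map _).map _
        obtain ⟨a, b, hab⟩ := G.exists_ends f.1
        rw [hab]
        rfl
      color_eq := fun _ => rfl }

/-- The part of a graph on the vertices with the property `P`. -/
@[reducible]
def restrict (M : ColoredGraph.{u} K) (P : M.V → Prop) : ColoredGraph.{u} K where
  V := {a // P a}
  E := {f : M.E // ∀ a ∈ M.ends f, P a}
  ends f := (M.ends f.1).attachWith f.2
  color f := M.color f.1
  finite_V := by have := M.finite_V; infer_instance
  finite_E := by have := M.finite_E; infer_instance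

/-- The graph obtained by identifying two vertices. -/
@[reducible]
def identify (M : ColoredGraph.{u} K) (p q : M.V) : ColoredGraph.{u} K where
  V := Quot fun a b => a = p ∧ b = q
  E := M.E
  ends f := (M.ends f).map (Quot.mk _)
  color := M.color
  finite_V := by have := M.finite_V; infer_instance
  finite_E := M.finite_E

/-- Walks stay inside a union of components. -/
theorem conn_restrict {M : ColoredGraph.{u} K} {P : M.V → Prop}
    (hP : ∀ a b, M.conn Set.univ a b → (P a ↔ P b)) {a b : M.V} (ha : P a) (hb : P b)
    (hab : M.conn Set.univ a b) : (M.restrict P).conn Set.univ ⟨a, ha⟩ ⟨b, hb⟩ := by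
  classical
  let F : M.V → {a // P a} := fun c => if h : P c then ⟨c, h⟩ else ⟨a, ha⟩
  have hF : ∀ c (hc : P c), F c = ⟨c, hc⟩ := fun c hc => dif_pos hc
  rw [← hF a ha, ← hF b hb]
  refine conn_rec ((M.restrict P).conn Set.univ) F (fun f _ c d e => ?_) hab
  have hcd := hP c d (conn_of_ends (Set.mem_univ f) e)
  by_cases hc : P c
  · have hd := hcd.1 hc
    rw [hF c hc, hF d hd]
    refine conn_of_ends (G := M.restrict P) (S := Set.univ)
      (f := (⟨f, by rw [e]; simp [hc, hd]⟩ : {f : M.E // ∀ a ∈ M.ends f, P a})) (Set.mem_univ _) ?_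
    refine Sym2.map.injective Subtype.val_injective ?_
    simp [e]
  · have h1 : F c = ⟨a, ha⟩ := dif_neg hc
    have h2 : F d = ⟨a, ha⟩ := dif_neg (mt hcd.2 hc)
    rw [h1, h2]

open scoped Classical in
/-- If the vertices with the property `P` form a union of components, then identifying a vertex
with the property and one without it amounts to splicing the two parts. -/
noncomputable def spliceRestrict (M : ColoredGraph.{u} K) {P : M.V → Prop}
    (hP : ∀ a b, M.conn Set.univ a b → (P a ↔ P b)) {p q : M.V} (hp : P p) (hq : ¬ P q) :
    Iso (splice (M.restrict P) (M.restrict fun a => ¬ P a) ⟨p, hp⟩ ⟨q, hq⟩) (M.identify p q) where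
  onV :=
    { toFun := Quot.lift (Sum.elim (fun a => Quot.mk _ a.1) fun a => Quot.mk _ a.1)
        (by rintro _ _ ⟨rfl, rfl⟩; exact Quot.sound ⟨rfl, rfl⟩)
      invFun := Quot.lift (fun a => if h : P a then Quot.mk _ (Sum.inl ⟨a, h⟩)
          else Quot.mk _ (Sum.inr ⟨a, h⟩))
        (by
          rintro _ _ ⟨rfl, rfl⟩
          refine (dif_pos hp).trans (Eq.trans ?_ (dif_neg hq).symm)
          exact Quot.sound ⟨rfl, rfl⟩)
      left_inv := by
        rintro ⟨⟨a, ha⟩ | ⟨a, ha⟩⟩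
        · exact dif_pos ha
        · exact dif_neg ha
      right_inv := by
        rintro ⟨a⟩
        by_cases ha : P a
        · exact congrArg (Quot.lift _ _) (dif_pos ha)
        · exact congrArg (Quot.lift _ _) (dif_neg ha) }
  onE := Equiv.ofBijective
    (Sum.elim (fun f : {f : M.E // ∀ a ∈ M.ends f, P a} => f.1)
      fun f : {f : M.E // ∀ a ∈ M.ends f, ¬ P a} => f.1) (by
    constructor
    · refine Function.Injective.sumElim Subtype.val_injective Subtype.val_injective ?_
      rintro ⟨f, hf⟩ ⟨g, hg⟩ (rfl : f = g)
      obtain ⟨a, b, h⟩ := M.exists_ends f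
      exact hg a (by simp [h]) (hf a (by simp [h]))
    · intro f
      obtain ⟨a, b, h⟩ := M.exists_ends f
      have hab := hP a b (conn_of_ends (G := M) (Set.mem_univ f) h)
      by_cases ha : P a
      · exact ⟨Sum.inl ⟨f, by rw [h]; simp [ha, hab.1 ha]⟩, rfl⟩
      · exact ⟨Sum.inr ⟨f, by rw [h]; simp [ha, mt hab.2 ha]⟩, rfl⟩)
  ends_eq := by
    rintro (⟨f, hf⟩ | ⟨f, hf⟩)
    · change (M.ends f).map _ = (((M.ends f).attachWith hf).map _).map _
      conv_lhs => rw [← Sym2.attachWith_map_subtypeVal hf]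
      generalize (M.ends f).attachWith hf = z
      induction z with | _ a b => rfl
    · change (M.ends f).map _ = (((M.ends f).attachWith hf).map _).map _
      conv_lhs => rw [← Sym2.attachWith_map_subtypeVal hf]
      generalize (M.ends f).attachWith hf = z
      induction z with | _ a b => rfl
  color_eq := by rintro (f | f) <;> rfl

/-- Identifying `p` with `q` and `p'` with `q'` gives graphs that differ by a vertex pivot if `p`, `p'`
and `q`, `q'` belong to two different components. -/
theorem cls_identify (M : ColoredGraph.{u} K) {p p' q q' : M.V} (hp : M.conn Set.univ p p')
    (hq : M.conn Set.univ q q') (hpq : ¬ M.conn Set.univ p q) :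
    (M.identify p q).cls = (M.identify p' q').cls := by
  let P : M.V → Prop := fun a => M.conn Set.univ p a
  have hP : ∀ a b, M.conn Set.univ a b → (P a ↔ P b) := fun a b h =>
    ⟨fun h' => Setoid.trans' _ h' h, fun h' => Setoid.trans' _ h' (Setoid.symm' _ h)⟩
  have hP' : ∀ a b, M.conn Set.univ a b → (¬ P a ↔ ¬ P b) := fun a b h => not_congr (hP a b h)
  have h1 : P p := Setoid.refl' _ p
  have h2 : ¬ P q' := (hP' q q' hq).1 hpq
  rw [← cls_eq_of_iso (spliceRestrict M hP h1 hpq),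
    ← cls_eq_of_iso (spliceRestrict M hP (p := p') hp h2)]
  exact Quot.sound (.pivot _ _ (conn_restrict hP _ _ hp) (conn_restrict hP' _ _ hq))

/-- Contracting a further edge in a minor amounts to identifying its endpoints. -/
def minorInsert (G : ColoredGraph.{u} K) (C S : Set G.E) (c : S → L) {f : G.E} {a b : G.V}
    (h : G.ends f = s(a, b)) :
    Iso (G.minor (insert f C) S c)
      ((G.minor C S c).identify (Quotient.mk (G.conn C) a) (Quotient.mk (G.conn C) b)) where
  onV :=
    { toFun := Quotient.lift (fun d => Quot.mk _ (Quotient.mk (G.conn C) d)) (by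
        intro d d' hd
        refine conn_rec ⊥ (fun d => Quot.mk _ (Quotient.mk (G.conn C) d)) ?_ hd
        rintro g (rfl | hg) k k' hk
        · rw [h] at hk
          rcases Sym2.eq_iff.1 hk with ⟨rfl, rfl⟩ | ⟨rfl, rfl⟩
          · exact Quot.sound ⟨rfl, rfl⟩
          · exact (Quot.sound ⟨rfl, rfl⟩).symm
        · exact congrArg (Quot.mk _) (Quotient.sound (conn_of_ends hg hk)))
      invFun := Quot.lift (Quotient.lift (fun d => Quotient.mk (G.conn (insert f C)) d)
          (fun d d' hd => Quotient.sound (conn_mono (Set.subset_insert _ _) hd))) (by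
        rintro _ _ ⟨rfl, rfl⟩
        exact Quotient.sound (conn_of_ends (Set.mem_insert _ _) h))
      left_inv := by rintro ⟨d⟩; rfl
      right_inv := by rintro ⟨⟨d⟩⟩; rfl }
  onE := Equiv.refl _
  ends_eq f := by
    change ((G.ends f.1).map _).map _ = ((G.ends f.1).map _).map _
    obtain ⟨a, b, hab⟩ := G.exists_ends f.1
    rw [hab]
    rfl
  color_eq _ := rfl

theorem conn_minor_iff {G : ColoredGraph.{u} K} {C S : Set G.E} {c : S → L} (T : Set S)
    {a b : G.V} :
    (G.minor C S c).conn T (Quotient.mk (G.conn C) a) (Quotient.mk (G.conn C) b) ↔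
      G.conn (C ∪ Subtype.val '' T) a b := by
  constructor
  · intro h
    refine Quotient.exact (s := G.conn (C ∪ Subtype.val '' T))
      (conn_rec (G := G.minor C S c) ⊥ (Quotient.lift (Quotient.mk (G.conn (C ∪ Subtype.val '' T)))
        fun d d' hd => Quotient.sound (conn_mono Set.subset_union_left hd)) ?_ h)
    intro f hf k k' e
    obtain ⟨d, d', hd⟩ := G.exists_ends f.1
    have hdd : G.conn (C ∪ Subtype.val '' T) d d' :=
      conn_of_ends (Or.inr (Set.mem_image_of_mem _ hf)) hd
    replace e : s(Quotient.mk (G.conn C) d, Quotient.mk (G.conn C) d') = s(k, k') := by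
      rw [← e]
      change _ = (G.ends f.1).map _
      rw [hd]
      rfl
    rcases Sym2.eq_iff.1 e with ⟨rfl, rfl⟩ | ⟨rfl, rfl⟩
    · exact Quotient.sound hdd
    · exact Quotient.sound (Setoid.symm' _ hdd)
  · intro h
    refine conn_rec ((G.minor C S c).conn T) (Quotient.mk (G.conn C)) ?_ h
    rintro f (hf | ⟨f, hf, rfl⟩) d d' e
    · have : Quotient.mk (G.conn C) d = Quotient.mk (G.conn C) d' :=
        Quotient.sound (conn_of_ends hf e)
      rw [this]
      exact Setoid.refl' _ _
    · refine conn_of_ends hf ?_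
      change (G.ends f.1).map _ = _
      rw [e]
      rfl

theorem mem_closure_minor {G : ColoredGraph.{u} K} {C S : Set G.E} {c : S → L} (T : Set S)
    (f : S) : f ∈ (G.minor C S c).closure T ↔ f.1 ∈ G.closure (C ∪ Subtype.val '' T) := by
  obtain ⟨a, b, h⟩ := G.exists_ends f.1
  have h' : (G.minor C S c).ends f = s(Quotient.mk (G.conn C) a, Quotient.mk (G.conn C) b) := by
    change (G.ends f.1).map _ = _
    rw [h]
    rfl
  rw [mem_closure h, ← conn_minor_iff T]
  exact mem_closure (G := G.minor C S c) h'

/-- Contracting either of two edges in series gives vertex pivot equivalent minors. -/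
theorem cls_minor_series {G : ColoredGraph.{u} K} {C S : Set G.E} {c : S → L} {f g : G.E}
    (hf : f ∉ G.closure (C ∪ S)) (hfg : f ∈ G.closure (insert g (C ∪ S))) :
    (G.minor (insert f C) S c).cls = (G.minor (insert g C) S c).cls := by
  have hconn : ∀ {a b}, G.conn (C ∪ S) a b → (G.minor C S c).conn Set.univ
      (Quotient.mk (G.conn C) a) (Quotient.mk (G.conn C) b) := fun h => conn_minor h
  obtain ⟨a, b, hab⟩ := G.exists_ends f
  obtain ⟨p, q, hpq, hap, hqb⟩ : ∃ p q, G.ends g = s(p, q) ∧ G.conn (C ∪ S) a p ∧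
      G.conn (C ∪ S) q b := by
    obtain ⟨p, q, hpq⟩ := G.exists_ends g
    rw [mem_closure hab] at hf hfg
    rcases (conn_insert hpq).1 hfg with h | ⟨h, h'⟩ | ⟨h, h'⟩
    · exact absurd h hf
    · exact ⟨p, q, hpq, h, h'⟩
    · exact ⟨q, p, hpq.trans Sym2.eq_swap, h, h'⟩
  rw [cls_eq_of_iso (minorInsert G C S c hab), cls_eq_of_iso (minorInsert G C S c hpq)]
  refine cls_identify _ (hconn hap) (hconn (Setoid.symm' _ hqb)) fun h => hf ?_
  have h := (conn_minor_iff Set.univ).1 h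
  rw [mem_closure hab]
  rwa [Set.image_univ, Subtype.range_coe] at h

/-- A minor of a minor is a minor. -/
def minorMinor {G : ColoredGraph.{u} K} {C S C'' S'' : Set G.E} {c : S → L} {C' S' : Set S}
    {L' : Type*} {c' : S' → L'} {c'' : S'' → L'} (hC : C ∪ Subtype.val '' C' = C'')
    (hS : ∀ f, f ∈ S'' ↔ ∃ h : f ∈ S, (⟨f, h⟩ : S) ∈ S')
    (hc : ∀ (f : S) (h : f ∈ S'), c' ⟨f, h⟩ = c'' ⟨f.1, (hS f.1).2 ⟨f.2, h⟩⟩) :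
    Iso ((G.minor C S c).minor C' S' c') (G.minor C'' S'' c'') where
  onV :=
    { toFun := Quotient.lift (Quotient.lift (Quotient.mk (G.conn C''))
          fun a b h => Quotient.sound (conn_mono (hC ▸ Set.subset_union_left) h)) (by
        rintro ⟨a⟩ ⟨b⟩ h
        subst hC
        exact Quotient.sound ((conn_minor_iff C').1 h))
      invFun := Quotient.lift (fun a => Quotient.mk _ (Quotient.mk (G.conn C) a)) (by
        intro a b h
        subst hC
        exact Quotient.sound ((conn_minor_iff C').2 h))
      left_inv := by rintro ⟨⟨a⟩⟩; rfl
      right_inv := by rintro ⟨a⟩; rfl }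
  onE :=
    { toFun := fun f => ⟨f.1.1, (hS f.1.1).2 ⟨f.1.2, f.2⟩⟩
      invFun := fun f => ⟨⟨f.1, ((hS f.1).1 f.2).1⟩, ((hS f.1).1 f.2).2⟩
      left_inv := fun _ => rfl
      right_inv := fun _ => rfl }
  ends_eq f := by
    change (G.ends f.1.1).map _ = (((G.ends f.1.1).map _).map _).map _
    obtain ⟨a, b, hab⟩ := G.exists_ends f.1.1
    rw [hab]
    rfl
  color_eq f := (hc f.1 f.2).symm

end ColoredGraph

/-! ### The relations of the Tutte ring -/

namespace TutteRing

open TutteVar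

variable (R : Type*) [CommRing R] {Λ : Type*}

theorem det_relations (l m : Λ) :
    X.elt R l * y.elt R m - y.elt R l * X.elt R m = x.elt R l * Y.elt R m - Y.elt R l * x.elt R m ∧
    x.elt R l * Y.elt R m - Y.elt R l * x.elt R m = x.elt R l * y.elt R m - y.elt R l * x.elt R m := by
  constructor
  · refine sub_eq_zero.1 (Ideal.Quotient.eq_zero_iff_mem.2 (Ideal.subset_span ⟨l, m, Or.inl ?_⟩))
    rw [Matrix.det_fin_two_of, Matrix.det_fin_two_of]
  · refine sub_eq_zero.1 (Ideal.Quotient.eq_zero_iff_mem.2 (Ideal.subset_span ⟨l, m, Or.inr ?_⟩))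
    rw [Matrix.det_fin_two_of, Matrix.det_fin_two_of]

theorem x_mul_Y_sub (l m : Λ) :
    x.elt R l * (Y.elt R m - y.elt R m) = x.elt R m * (Y.elt R l - y.elt R l) := by
  linear_combination (det_relations R l m).2

theorem y_mul_X_sub (l m : Λ) :
    y.elt R m * (X.elt R l - x.elt R l) = y.elt R l * (X.elt R m - x.elt R m) := by
  linear_combination (det_relations R l m).1 + (det_relations R l m).2

end TutteRing

namespace ColoredGraph

/-! ### Graphs with a distinguished edge -/

section PointedOp

variable {K : Type v}

open scoped Classical in
theorem pointedOp_of_isPointed {Q : (Γ : ColoredGraph.{u} (Option K)) → Γ.E → Prop}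
    {op : (Γ : ColoredGraph.{u} (Option K)) → Γ.E → ColoredGraph.{u} (Option K)}
    {Γ : ColoredGraph.{u} (Option K)} {f : Γ.E} (hf : Γ.IsPointed f) :
    pointedOp Q op Γ = if Q Γ f then some (op Γ f).cls else none := by
  have huniq : ∀ g, Γ.IsPointed g → g = f := fun g hg => (hf g).1 ((hg g).2 rfl)
  unfold pointedOp
  by_cases h : ∃ g, Γ.IsPointed g ∧ Q Γ g
  · have h' := h.choose_spec
    have heq := huniq _ h'.1
    rw [dif_pos h, heq]
    rw [heq] at h'
    rw [if_pos h'.2]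
  · rw [dif_neg h, if_neg fun h' => h ⟨f, hf, h'⟩]

theorem keepBridge_cls (Γ : ColoredGraph.{u} (Option K)) : VP.keepBridge Γ.cls =
    pointedOp (fun Γ f => Γ.IsBridge f) (fun Γ _ => Γ) Γ := rfl

theorem keepLoop_cls (Γ : ColoredGraph.{u} (Option K)) : VP.keepLoop Γ.cls =
    pointedOp (fun Γ f => Γ.IsLoop f) (fun Γ _ => Γ) Γ := rfl

theorem keepZero_cls (Γ : ColoredGraph.{u} (Option K)) : VP.keepZero Γ.cls =
    pointedOp (fun Γ f => ¬ Γ.IsLoop f ∧ ¬ Γ.IsBridge f) (fun Γ _ => Γ) Γ := rfl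

theorem contract_cls (Γ : ColoredGraph.{u} (Option K)) : VP.contract Γ.cls =
    pointedOp (fun Γ f => ¬ Γ.IsLoop f) contractEdge Γ := rfl

theorem delete_cls (Γ : ColoredGraph.{u} (Option K)) : VP.delete Γ.cls =
    pointedOp (fun Γ f => ¬ Γ.IsBridge f) deleteEdge Γ := rfl

end PointedOp

/-! ### The pointed polynomials as expansions -/

section Terminal

variable (R : Type*) [CommRing R] {Λ₁ : Type*} {Λ₀ : Type v}
  (G : ColoredGraph.{u} (Λ₁ ⊕ Option Λ₀)) (e : G.E)

/-- The zero edges other than `e`. -/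
def otherZeroEdges : Set G.E := G.zeroEdges \ {e}

/-- The class of the graph on the zero edges other than `e` obtained by contracting `C` and deleting
all other edges, as a variable of the pointed Tutte ring. -/
noncomputable def otherTerminal (C : Set G.E) : PointedTutteRing.{u} R Λ₁ (Option Λ₀) :=
  MvPolynomial.X (G.minor C (G.otherZeroEdges e) fun f => (G.color f).getRight f.2.1).cls

variable {G e}

theorem otherTerminal_congr (C C' : Set G.E) (h : G.closure C = G.closure C') :
    G.otherTerminal R e C = G.otherTerminal R e C' :=
  congrArg MvPolynomial.X (cls_minor_congr (conn_eq_of_closure_eq h))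

theorem otherTerminal_series (C : Set G.E) (f g : G.E)
    (hf : f ∉ G.closure (C ∪ G.otherZeroEdges e)) (_ : g ∉ G.closure (C ∪ G.otherZeroEdges e))
    (hfg : f ∈ G.closure (insert g (C ∪ G.otherZeroEdges e))) :
    G.otherTerminal R e (insert f C) = G.otherTerminal R e (insert g C) :=
  congrArg MvPolynomial.X (cls_minor_series hf hfg)

theorem edgeVar_x_mul_Y_sub {f g : G.E} (hf : f ∉ G.zeroEdges) (hg : g ∉ G.zeroEdges) :
    G.edgeVar R .x f * (G.edgeVar R .Y g - G.edgeVar R .y g) =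
      G.edgeVar R .x g * (G.edgeVar R .Y f - G.edgeVar R .y f) := by
  obtain ⟨l, hl⟩ := exists_color_of_notMem hf
  obtain ⟨m, hm⟩ := exists_color_of_notMem hg
  simpa [edgeVar, hl, hm] using TutteRing.x_mul_Y_sub R l m

theorem edgeVar_y_mul_X_sub {f g : G.E} (hf : f ∉ G.zeroEdges) (hg : g ∉ G.zeroEdges) :
    G.edgeVar R .y g * (G.edgeVar R .X f - G.edgeVar R .x f) =
      G.edgeVar R .y f * (G.edgeVar R .X g - G.edgeVar R .x g) := by
  obtain ⟨l, hl⟩ := exists_color_of_notMem hf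
  obtain ⟨m, hm⟩ := exists_color_of_notMem hg
  simpa [edgeVar, hl, hm] using TutteRing.y_mul_X_sub R l m

theorem edgeVar_X_mul_y_sub {f g : G.E} (hf : f ∉ G.zeroEdges) (hg : g ∉ G.zeroEdges) :
    G.edgeVar R .X f * G.edgeVar R .y g - G.edgeVar R .X g * G.edgeVar R .y f =
      G.edgeVar R .x f * G.edgeVar R .Y g - G.edgeVar R .x g * G.edgeVar R .Y f := by
  obtain ⟨l, hl⟩ := exists_color_of_notMem hf
  obtain ⟨m, hm⟩ := exists_color_of_notMem hg
  simp only [edgeVar, hl, hm]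
  linear_combination (TutteRing.det_relations R l m).1

theorem edgeCoeff_eq {f : G.E} {m : Λ₁} (h : G.color f = Sum.inl m) (t : TutteVar) :
    G.edgeCoeff R t f = t.pointedElt R (Option Λ₀) m := by
  simp only [edgeCoeff, edgeVar, h, TutteVar.pointedElt]

theorem pointedElt_x_mul_Y_sub (l m : Λ₁) :
    TutteVar.x.pointedElt.{u} R Λ₀ l *
        (TutteVar.Y.pointedElt R Λ₀ m - TutteVar.y.pointedElt R Λ₀ m) =
      (TutteVar.Y.pointedElt R Λ₀ l - TutteVar.y.pointedElt R Λ₀ l) *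
        TutteVar.x.pointedElt R Λ₀ m := by
  have h := congrArg (MvPolynomial.C (σ := VP.{u} Λ₀))
    ((TutteRing.x_mul_Y_sub R l m).trans (mul_comm _ _))
  rwa [map_mul, map_mul, map_sub, map_sub] at h

theorem pointedElt_y_mul_X_sub (l m : Λ₁) :
    TutteVar.y.pointedElt.{u} R Λ₀ l *
        (TutteVar.X.pointedElt R Λ₀ m - TutteVar.x.pointedElt R Λ₀ m) =
      (TutteVar.X.pointedElt R Λ₀ l - TutteVar.x.pointedElt R Λ₀ l) *
        TutteVar.y.pointedElt R Λ₀ m := by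
  have h := congrArg (MvPolynomial.C (σ := VP.{u} Λ₀))
    ((TutteRing.y_mul_X_sub R m l).trans (mul_comm _ _))
  rwa [map_mul, map_mul, map_sub, map_sub] at h

/-- The relative Tutte polynomial of `G / e` (for `K = {e}`) or `G - e` (for `K = ∅`), computed with
any labeling, is an expansion along any list of the regular edges of `G`. -/
theorem relTutte_minor_eq_expand (he : e ∈ G.zeroEdges) (K : Set G.E)
    {φ' : ({e}ᶜ : Set G.E) → ℕ}
    (hφ' : (G.minor K {e}ᶜ fun f => G.color f).IsProperLabeling
      (G.minor K {e}ᶜ fun f => G.color f).zeroEdges φ')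
    {l : List G.E} (hnodup : l.Nodup) (hl : ∀ f, f ∈ l ↔ f ∉ G.zeroEdges) :
    (G.minor K {e}ᶜ fun f => G.color f).relTutte R φ' =
      expand G.closure (G.edgeCoeff R) (G.otherZeroEdges e) (G.otherTerminal R e) l K := by
  obtain ⟨l', hl'⟩ : ∃ l' : List ({e}ᶜ : Set G.E), _ := exists_isRegularList hφ'
  refine (relTutte_eq_expand R hφ' hl').trans ((expand_map (cl := G.closure) (w := G.edgeCoeff R)
    (H := G.otherZeroEdges e) (Z := G.otherTerminal R e)
    (cl' := (G.minor K {e}ᶜ fun f => G.color f).closure)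
    (Subtype.val : ({e}ᶜ : Set G.E) → G.E) K mem_closure_minor (fun _ _ => rfl) ?_ ?_ l' ∅).trans ?_)
  · ext f
    constructor
    · rintro ⟨g, hg, rfl⟩
      exact ⟨hg, g.2⟩
    · rintro ⟨hf, hfe⟩
      exact ⟨⟨f, hfe⟩, hf, rfl⟩
  · intro C
    refine congrArg MvPolynomial.X (cls_eq_of_iso (minorMinor rfl ?_ fun _ _ => rfl))
    exact fun f => ⟨fun h => ⟨h.2, h.1⟩, fun ⟨h, h'⟩ => ⟨h', h⟩⟩
  · have hK : K ∪ (Subtype.val : ({e}ᶜ : Set G.E) → G.E) '' ∅ = K := by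
      rw [Set.image_empty, Set.union_empty]
    refine (congrArg (expand G.closure (G.edgeCoeff R) (G.otherZeroEdges e) (G.otherTerminal R e)
      (l'.map Subtype.val)) hK).trans ?_
    have hmem : ∀ f, f ∈ l'.map Subtype.val ↔ f ∉ G.zeroEdges := by
      intro f
      rw [List.mem_map]
      constructor
      · rintro ⟨g, hg, rfl⟩
        exact (hl'.mem_iff g).1 hg
      · intro hf
        exact ⟨⟨f, fun h => hf (by rw [h]; exact he)⟩, (hl'.mem_iff _).2 hf, rfl⟩
    have hperm : (l'.map Subtype.val).Perm l :=
      (List.perm_ext_iff_of_nodup (hl'.nodup.map Subtype.val_injective) hnodup).2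
        fun f => (hmem f).trans (hl f).symm
    refine expand_perm G.closure_exchange (otherTerminal_congr R) (otherTerminal_series R)
      (P := fun f => f ∉ G.zeroEdges) ?_ ?_ ?_ hperm (fun f hf => (hmem f).1 hf) K
    · intro f g hf hg
      simpa [edgeCoeff] using congrArg MvPolynomial.C (edgeVar_x_mul_Y_sub R hf hg)
    · intro f g hf hg
      simpa [edgeCoeff] using congrArg MvPolynomial.C (edgeVar_y_mul_X_sub R hf hg)
    · intro f g hf hg
      simpa [edgeCoeff] using congrArg MvPolynomial.C (edgeVar_X_mul_y_sub R hf hg)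

theorem mem_zeroEdges_of_color (he : ∀ f, G.color f = Sum.inr none ↔ f = e) :
    e ∈ G.zeroEdges := by
  simp [zeroEdges, (he e).2 rfl]

/-- The distinguished edge as an edge of the graph on the zero edges. -/
def terminalEdge (he : ∀ f, G.color f = Sum.inr none ↔ f = e) (C : Set G.E) : (G.terminal C).E :=
  (⟨e, mem_zeroEdges_of_color he⟩ : G.zeroEdges)

theorem terminalEdge_isPointed (he : ∀ f, G.color f = Sum.inr none ↔ f = e) (C : Set G.E) :
    (G.terminal C).IsPointed (terminalEdge he C) := by
  rintro ⟨g, hg⟩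
  refine Iff.trans ?_ ((he g).trans Subtype.mk_eq_mk.symm)
  change (G.color g).getRight hg = none ↔ _
  exact Sum.getRight_eq_iff hg

theorem terminalEdge_isLoop_iff (he : ∀ f, G.color f = Sum.inr none ↔ f = e) (C : Set G.E) :
    (G.terminal C).IsLoop (terminalEdge he C) ↔ e ∈ G.closure C := by
  refine isLoop_iff.trans ((mem_closure_minor ∅ _).trans ?_)
  rw [Set.image_empty, Set.union_empty]
  rfl

theorem terminalEdge_isBridge_iff (he : ∀ f, G.color f = Sum.inr none ↔ f = e) (C : Set G.E) :
    (G.terminal C).IsBridge (terminalEdge he C) ↔ e ∉ G.closure (C ∪ G.otherZeroEdges e) := by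
  refine isBridge_iff.trans (not_congr ((mem_closure_minor _ _).trans ?_))
  have h : Subtype.val '' ({⟨e, mem_zeroEdges_of_color he⟩}ᶜ : Set G.zeroEdges) =
      G.otherZeroEdges e := by
    ext f
    constructor
    · rintro ⟨g, hg, rfl⟩
      exact ⟨g.2, fun h => hg (Subtype.ext h)⟩
    · rintro ⟨hf, hfe⟩
      exact ⟨⟨f, hf⟩, fun h => hfe (congrArg Subtype.val h), rfl⟩
  exact iff_of_eq (congrArg (fun S => e ∈ G.closure (C ∪ S)) h)

theorem X_terminal_contractEdge (he : ∀ f, G.color f = Sum.inr none ↔ f = e) (C : Set G.E) :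
    (MvPolynomial.X ((G.terminal C).contractEdge (terminalEdge he C)).cls :
      PointedTutteRing.{u} R Λ₁ (Option Λ₀)) = G.otherTerminal R e (insert e C) := by
  refine congrArg MvPolynomial.X (cls_eq_of_iso (minorMinor
    (S := G.zeroEdges)
    (C' := ({terminalEdge he C} : Set (G.terminal C).E))
    (S' := ({terminalEdge he C}ᶜ : Set (G.terminal C).E))
    (c' := fun f => (G.terminal C).color f.1) ?_ ?_ fun _ _ => rfl))
  · exact (congrArg (C ∪ ·) (Set.image_singleton (f := (Subtype.val : G.zeroEdges → G.E)))).trans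
      Set.union_singleton
  · exact fun f => ⟨fun h => ⟨h.1, fun h' => h.2 (congrArg Subtype.val h')⟩,
      fun ⟨h, h'⟩ => ⟨h, fun h'' => h' (Subtype.ext h'')⟩⟩

theorem X_terminal_deleteEdge (he : ∀ f, G.color f = Sum.inr none ↔ f = e) (C : Set G.E) :
    (MvPolynomial.X ((G.terminal C).deleteEdge (terminalEdge he C)).cls :
      PointedTutteRing.{u} R Λ₁ (Option Λ₀)) = G.otherTerminal R e C := by
  refine congrArg MvPolynomial.X (cls_eq_of_iso (minorMinor
    (S := G.zeroEdges) (C' := ∅)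
    (S' := ({terminalEdge he C}ᶜ : Set (G.terminal C).E))
    (c' := fun f => (G.terminal C).color f.1) ?_ ?_ fun _ _ => rfl))
  · rw [Set.image_empty, Set.union_empty]
  · exact fun f => ⟨fun h => ⟨h.1, fun h' => h.2 (congrArg Subtype.val h')⟩,
      fun ⟨h, h'⟩ => ⟨h, fun h'' => h' (Subtype.ext h'')⟩⟩

open scoped Classical in
/-- The operations on classes by which the endomorphisms of the pointed Tutte ring are defined,
applied to a graph on the zero edges. -/
theorem piMap_X_terminal (he : ∀ f, G.color f = Sum.inr none ↔ f = e)
    {m : VP.{u} (Option Λ₀) → Option (VP.{u} (Option Λ₀))}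
    {Q : (Γ : ColoredGraph.{u} (Option Λ₀)) → Γ.E → Prop}
    {op : (Γ : ColoredGraph.{u} (Option Λ₀)) → Γ.E → ColoredGraph.{u} (Option Λ₀)}
    (hm : ∀ Γ : ColoredGraph.{u} (Option Λ₀), m Γ.cls = pointedOp Q op Γ) (C : Set G.E) :
    piMap R Λ₁ m (MvPolynomial.X (G.terminal C).cls) =
      if Q (G.terminal C) (terminalEdge he C) then
        MvPolynomial.X (op (G.terminal C) (terminalEdge he C)).cls else 0 := by
  rw [piMap, MvPolynomial.aeval_X, hm, pointedOp_of_isPointed (terminalEdge_isPointed he C)]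
  split_ifs <;> rfl

theorem piMap_edgeCoeff (m : VP.{u} (Option Λ₀) → Option (VP.{u} (Option Λ₀))) (t : TutteVar)
    (f : G.E) : piMap R Λ₁ m (G.edgeCoeff R t f) = G.edgeCoeff R t f :=
  (piMap R Λ₁ m).commutes (G.edgeVar R t f)

/-- The endomorphisms of the pointed Tutte ring fix all weights, so that they only act on the final
evaluation of an expansion. -/
theorem piMap_piMap_relTutte {φ : G.E → ℕ} (hφ : G.IsProperLabeling G.zeroEdges φ) {l : List G.E}
    (hl : G.IsRegularList φ l) (m m' : VP.{u} (Option Λ₀) → Option (VP.{u} (Option Λ₀))) :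
    piMap R Λ₁ m (piMap R Λ₁ m' (G.relTutte R φ)) =
      expand G.closure (G.edgeCoeff R) G.zeroEdges
        (fun C => piMap R Λ₁ m (piMap R Λ₁ m' (MvPolynomial.X (G.terminal C).cls))) l ∅ := by
  rw [relTutte_eq_expand R hφ hl]
  exact (congrArg (piMap R Λ₁ m) (map_expand (piMap R Λ₁ m') (piMap_edgeCoeff R m') l ∅)).trans
    (map_expand (piMap R Λ₁ m) (piMap_edgeCoeff R m) l ∅)

open scoped Classical in
theorem piContract_piC_X (he : ∀ f, G.color f = Sum.inr none ↔ f = e) (C : Set G.E) :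
    piContract R Λ₁ (piC R Λ₁ (MvPolynomial.X (G.terminal C).cls)) =
      if e ∈ G.closure (C ∪ G.otherZeroEdges e) then 0 else G.otherTerminal R e (insert e C) := by
  rw [piMap_X_terminal R he keepBridge_cls, terminalEdge_isBridge_iff]
  by_cases h : e ∈ G.closure (C ∪ G.otherZeroEdges e)
  · rw [if_neg (not_not.2 h), if_pos h, map_zero]
  · have h' : e ∉ G.closure C := mt (ClosureOperator.mem_mono Set.subset_union_left) h
    rw [if_pos h, if_neg h, piMap_X_terminal R he contract_cls, terminalEdge_isLoop_iff,
      if_pos h', X_terminal_contractEdge]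

open scoped Classical in
theorem piDelete_piL_X (he : ∀ f, G.color f = Sum.inr none ↔ f = e) (C : Set G.E) :
    piDelete R Λ₁ (piL R Λ₁ (MvPolynomial.X (G.terminal C).cls)) =
      if e ∈ G.closure C then G.otherTerminal R e C else 0 := by
  rw [piMap_X_terminal R he keepLoop_cls, terminalEdge_isLoop_iff]
  by_cases h : e ∈ G.closure C
  · have h' : ¬ e ∉ G.closure (C ∪ G.otherZeroEdges e) :=
      not_not.2 (ClosureOperator.mem_mono Set.subset_union_left h)
    rw [if_pos h, if_pos h, piMap_X_terminal R he delete_cls, terminalEdge_isBridge_iff,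
      if_pos h', X_terminal_deleteEdge]
  · rw [if_neg h, if_neg h, map_zero]

open scoped Classical in
theorem piContract_piZero_X (he : ∀ f, G.color f = Sum.inr none ↔ f = e) (C : Set G.E) :
    piContract R Λ₁ (piZero R Λ₁ (MvPolynomial.X (G.terminal C).cls)) =
      if e ∉ G.closure C ∧ e ∈ G.closure (C ∪ G.otherZeroEdges e) then
        G.otherTerminal R e (insert e C) else 0 := by
  rw [piMap_X_terminal R he keepZero_cls, terminalEdge_isLoop_iff, terminalEdge_isBridge_iff,
    not_not]
  by_cases h : e ∉ G.closure C ∧ e ∈ G.closure (C ∪ G.otherZeroEdges e)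
  · rw [if_pos h, if_pos h, piMap_X_terminal R he contract_cls, terminalEdge_isLoop_iff,
      if_pos h.1, X_terminal_contractEdge]
  · rw [if_neg h, if_neg h, map_zero]

open scoped Classical in
theorem piDelete_piZero_X (he : ∀ f, G.color f = Sum.inr none ↔ f = e) (C : Set G.E) :
    piDelete R Λ₁ (piZero R Λ₁ (MvPolynomial.X (G.terminal C).cls)) =
      if e ∉ G.closure C ∧ e ∈ G.closure (C ∪ G.otherZeroEdges e) then
        G.otherTerminal R e C else 0 := by
  rw [piMap_X_terminal R he keepZero_cls, terminalEdge_isLoop_iff, terminalEdge_isBridge_iff,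
    not_not]
  by_cases h : e ∉ G.closure C ∧ e ∈ G.closure (C ∪ G.otherZeroEdges e)
  · rw [if_pos h, if_pos h, piMap_X_terminal R he delete_cls, terminalEdge_isBridge_iff,
      if_pos (not_not.2 h.2), X_terminal_deleteEdge]
  · rw [if_neg h, if_neg h, map_zero]

end Terminal

end ColoredGraph

theorem theorem4p13 (R : Type*) [CommRing R] {Λ₁ : Type*} {Λ₀ : Type v}
    (G : ColoredGraph.{u} (Λ₁ ⊕ Option Λ₀)) (hG : G.IsConnected)
    (e : G.E) (he : ∀ f, G.color f = Sum.inr none ↔ f = e)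
    (hloop : ¬ G.IsLoop e) (hbridge : ¬ G.IsBridge e)
    (φ : G.E → ℕ) (hφ : G.IsProperLabeling G.zeroEdges φ)
    (φc : (G.contractEdge e).E → ℕ)
    (hφc : (G.contractEdge e).IsProperLabeling (G.contractEdge e).zeroEdges φc)
    (φd : (G.deleteEdge e).E → ℕ)
    (hφd : (G.deleteEdge e).IsProperLabeling (G.deleteEdge e).zeroEdges φd)
    (μ : Λ₁) :
    TutteVar.x.pointedElt R (Option Λ₀) μ * (G.pointedContract R φ e φc - G.pointedC R φ) =
        (TutteVar.Y.pointedElt R (Option Λ₀) μ - TutteVar.y.pointedElt R (Option Λ₀) μ)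
          * G.pointedL R φ ∧
    TutteVar.y.pointedElt R (Option Λ₀) μ * (G.pointedDelete R φ e φd - G.pointedL R φ) =
        (TutteVar.X.pointedElt R (Option Λ₀) μ - TutteVar.x.pointedElt R (Option Λ₀) μ)
          * G.pointedC R φ := by
  classical
  obtain ⟨l, hl⟩ := ColoredGraph.exists_isRegularList hφ
  have heH := ColoredGraph.mem_zeroEdges_of_color he
  have hH : G.zeroEdges = insert e (G.otherZeroEdges e) :=
    (Set.insert_sdiff_self_of_mem heH).symm
  have hC : G.pointedC R φ = _ := ColoredGraph.piMap_piMap_relTutte R hφ hl _ _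
  have hL : G.pointedL R φ = _ := ColoredGraph.piMap_piMap_relTutte R hφ hl _ _
  have h0c := ColoredGraph.piMap_piMap_relTutte R hφ hl VP.contract VP.keepZero
  have h0d := ColoredGraph.piMap_piMap_relTutte R hφ hl VP.delete VP.keepZero
  simp only [ColoredGraph.piContract_piC_X R he] at hC
  simp only [ColoredGraph.piDelete_piL_X R he] at hL
  simp only [ColoredGraph.piContract_piZero_X R he] at h0c
  simp only [ColoredGraph.piDelete_piZero_X R he] at h0d
  have hc : (G.contractEdge e).relTutte R φc = _ :=
    ColoredGraph.relTutte_minor_eq_expand R heH {e} hφc hl.nodup hl.mem_iff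
  have hd : (G.deleteEdge e).relTutte R φd = _ :=
    ColoredGraph.relTutte_minor_eq_expand R heH ∅ hφd hl.nodup hl.mem_iff
  have hsplit : ∀ S, e ∈ G.closure S → e ∈ G.closure (S ∪ G.otherZeroEdges e) :=
    fun S => ClosureOperator.mem_mono Set.subset_union_left
  have hreg := fun f hf => ColoredGraph.exists_color_of_notMem ((hl.mem_iff f).1 hf)
  constructor
  · -- `π_/ T_0 + T_C` collects the terms in which `e` does not become a loop
    have hsum : piContract R Λ₁ (G.pointedZero R φ) + G.pointedC R φ =
        expand G.closure (G.edgeCoeff R) G.zeroEdges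
          (fun C => if e ∈ G.closure C then 0 else G.otherTerminal R e (insert e C)) l ∅ := by
      refine (congrArg₂ _ h0c hC).trans ((expand_add l ∅).symm.trans ?_)
      congr 1
      funext C
      by_cases h1 : e ∈ G.closure C
      · simp [h1, hsplit C h1]
      · by_cases h2 : e ∈ G.closure (C ∪ G.otherZeroEdges e) <;> simp [h1, h2]
    have key := expand_contract_sub G.closure_exchange (ColoredGraph.otherTerminal_congr R)
      (H := G.otherZeroEdges e) (w := G.edgeCoeff R) (Z := G.otherTerminal R e) (e := e)
      (a := TutteVar.x.pointedElt R (Option Λ₀) μ)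
      (b := TutteVar.Y.pointedElt R (Option Λ₀) μ - TutteVar.y.pointedElt R (Option Λ₀) μ) l
      (fun f hf => by
        obtain ⟨m, hm⟩ := hreg f hf
        simp only [ColoredGraph.edgeCoeff_eq R hm]
        exact ColoredGraph.pointedElt_x_mul_Y_sub R μ m)
      (C := ∅) (mt ColoredGraph.isLoop_iff.2 hloop)
    rw [← hH, insert_empty_eq, ← hsum] at key
    rw [hL, ← key, ColoredGraph.pointedContract, hc]
    exact congrArg _ (sub_sub (α := PointedTutteRing R Λ₁ (Option Λ₀)) _ _ _)
  · -- `π_- T_0 + T_L` collects the terms in which `e` does not become a bridge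
    have hsum : piDelete R Λ₁ (G.pointedZero R φ) + G.pointedL R φ =
        expand G.closure (G.edgeCoeff R) G.zeroEdges
          (fun C => if e ∈ G.closure (C ∪ G.otherZeroEdges e) then G.otherTerminal R e C else 0)
          l ∅ := by
      refine (congrArg₂ _ h0d hL).trans ((expand_add l ∅).symm.trans ?_)
      congr 1
      funext C
      by_cases h1 : e ∈ G.closure C
      · simp [h1, hsplit C h1]
      · by_cases h2 : e ∈ G.closure (C ∪ G.otherZeroEdges e) <;> simp [h1, h2]
    have hspan : e ∈ G.closure (∅ ∪ ({g | g ∈ l} ∪ G.otherZeroEdges e)) := by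
      refine ClosureOperator.mem_mono (fun f hf => ?_)
        (not_not.1 (mt ColoredGraph.isBridge_iff.2 hbridge))
      by_cases hfH : f ∈ G.zeroEdges
      · exact Or.inr (Or.inr ⟨hfH, hf⟩)
      · exact Or.inr (Or.inl ((hl.mem_iff f).2 hfH))
    have key := expand_delete_sub G.closure_exchange (ColoredGraph.otherTerminal_series R)
      (w := G.edgeCoeff R) (a := TutteVar.y.pointedElt R (Option Λ₀) μ)
      (b := TutteVar.X.pointedElt R (Option Λ₀) μ - TutteVar.x.pointedElt R (Option Λ₀) μ) l
      (fun f hf => by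
        obtain ⟨m, hm⟩ := hreg f hf
        simp only [ColoredGraph.edgeCoeff_eq R hm]
        exact ColoredGraph.pointedElt_y_mul_X_sub R μ m)
      (C := ∅) hspan
    rw [← hH, ← hsum] at key
    rw [hC, ← key, ColoredGraph.pointedDelete, hd]
    exact congrArg _ (sub_sub (α := PointedTutteRing R Λ₁ (Option Λ₀)) _ _ _)
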